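/- Throughout, a partially directed graph on a finite node set $\mathbf V$ has at most one edge between any two distinct nodes, either directed ($A\to B$) or undirected ($A-B$), and no loops; a DAG has only directed edges and no directed cycle. An unshielded collider is $A\to B\leftarrow C$ with $A\neq C$ not adjacent. DAGs with the same adjacencies and the same unshielded colliders form a Markov equivalence class; its CPDAG has the same adjacencies and directs exactly the edges on whose direction all DAGs of the class agree. An MPDAG is a graph $\mathcal G$ obtained from a CPDAG by directing some of its undirected edges (background knowledge that agrees with at least one DAG of the class) and completing Meek's orientation rules R1–R4. $[\mathcal G]$ is the set of DAGs with the adjacencies, the unshielded colliders and the directed edges of $\mathcal G$. A path is a sequence of distinct, successively adjacent nodes; a path $\langle V_1,\dots,V_k\rangle$, $k>1$, is possibly causal if $\mathcal G$ has no edge $V_i\leftarrow V_j$ with $i<j$; a path from $\mathbf X$ to $\mathbf Y$ is proper if only its first node is in $\mathbf X$. A family $\mathbf F^*=\{f(\mathbf v\mid do(\mathbf a)):\mathbf A\subseteq\mathbf V\}$ of interventional densities of real random variables $\mathbf V$ is compatible with a DAG $\mathcal D$ if the observational density $f(\mathbf v)$ is a strictly positive probability density and $$f(\mathbf v\mid do(\mathbf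 a))=\prod_{V_i\in\mathbf V\setminus\mathbf A} f(v_i\mid \mathrm{pa}(v_i,\mathcal D))\,\mathbb 1(\mathbf A=\mathbf a)$$ for all $\mathbf A\subseteq \mathbf V$ and all $\mathbf a$, where $f(v_i\mid \mathrm{pa}(v_i,\mathcal D))$ are the conditional densities of $f(\mathbf v)$. For pairwise disjoint $\mathbf X,\mathbf Y,\mathbf Z\subseteq\mathbf V$, the conditional causal effect of $\mathbf X$ on $\mathbf Y$ given $\mathbf Z$ is identifiable in $\mathcal G$ if, for any families $\mathbf F^*_1,\mathbf F^*_2$ compatible with DAGs $\mathcal D_1,\mathcal D_2\in[\mathcal G]$ respectively such that $f_1(\mathbf v)=f_2(\mathbf v)$, one has $f_1(\mathbf y\mid do(\mathbf x),\mathbf z)=f_2(\mathbf y\mid do(\mathbf x),\mathbf z)$ (for almost every $(\mathbf x,\mathbf y,\mathbf z)$), where $f_i(\mathbf y\mid do(\mathbf x),\mathbf z)=f_i(\mathbf y,\mathbf z\mid do(\mathbf x))/f_i(\mathbf z\mid do(\mathbf x))$. **Proposition.** Let $\mathbf X$, $\mathbf Y$, and $\mathbf Z$ be pairwise disjoint node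 sets in a causal MPDAG $\mathcal G$. If there is a proper possibly causal path from $\mathbf X$ to $\mathbf Y$ in $\mathcal G$ that starts with an undirected edge and does not contain any element of $\mathbf Z$, then the conditional causal effect of $\mathbf X$ on $\mathbf Y$ given $\mathbf Z$ is not identifiable in $\mathcal G$. -/

import Mathlib

open MeasureTheory
open scoped ENNReal

/-- A partially directed graph on the node set `V`: between two distinct nodes there is at most
one edge, which is either directed (`Dir a b` is `a → b`) or undirected (`Undir a b` is `a - b`). -/
structure PDGraph (V : Type*) where
  Dir : V → V → Prop
  Undir : V → V → Prop
  dir_asymm : ∀ a b, Dir a b → ¬ Dir b a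
  undir_symm : ∀ a b, Undir a b → Undir b a
  undir_irrefl : ∀ a, ¬ Undir a a
  not_undir_of_dir : ∀ a b, Dir a b → ¬ Undir a b

namespace PDGraph

variable {V : Type*}

/-- Adjacency: some edge joins the two nodes. -/
def Adj (G : PDGraph V) (a b : V) : Prop := G.Dir a b ∨ G.Dir b a ∨ G.Undir a b

/-- There is no directed cycle. -/
def Acyclic (G : PDGraph V) : Prop := ∀ a, ¬ Relation.TransGen G.Dir a a

/-- A directed acyclic graph: every edge is directed and there is no directed cycle. -/
def IsDAG (D : PDGraph V) : Prop := (∀ a b, ¬ D.Undir a b) ∧ D.Acyclic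

/-- `a → b ← c` with `a` and `c` distinct and not adjacent. -/
def UnshieldedCollider (G : PDGraph V) (a b c : V) : Prop :=
  G.Dir a b ∧ G.Dir c b ∧ a ≠ c ∧ ¬ G.Adj a c

/-- Same adjacencies and same unshielded colliders. For DAGs this is Markov equivalence. -/
def SameAdjColliders (G H : PDGraph V) : Prop :=
  (∀ a b, G.Adj a b ↔ H.Adj a b) ∧
  ∀ a b c, G.UnshieldedCollider a b c ↔ H.UnshieldedCollider a b c

/-- `C` is the completed PDAG of the Markov equivalence class of some DAG `D`: it has the
adjacencies of that class, and an edge is directed in `C` exactly when all the DAGs of the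
class agree on its direction. -/
def IsCPDAG (C : PDGraph V) : Prop :=
  ∃ D : PDGraph V, D.IsDAG ∧ (∀ a b, C.Adj a b ↔ D.Adj a b) ∧
    ∀ a b, C.Dir a b ↔
      ∀ D' : PDGraph V, D'.IsDAG → D.SameAdjColliders D' → D'.Dir a b

/-- The DAG `D` is represented by `G`, that is, `D ∈ [G]`: it has the adjacencies, the directed
edges and the unshielded colliders of `G`. -/
def Represents (G D : PDGraph V) : Prop :=
  D.IsDAG ∧ G.SameAdjColliders D ∧ ∀ a b, G.Dir a b → D.Dir a b

/-- `H` arises from `G` by directing the undirected edge `a - b` as `a → b` for all `a`, `b`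
with `K a b`. -/
def OrientedBy (G : PDGraph V) (K : V → V → Prop) (H : PDGraph V) : Prop :=
  (∀ a b, K a b → G.Undir a b) ∧
  (∀ a b, H.Dir a b ↔ G.Dir a b ∨ K a b) ∧
  (∀ a b, H.Undir a b ↔ G.Undir a b ∧ ¬ K a b ∧ ¬ K b a)

/-- `G.MeekRule a b`: one of Meek's four orientation rules applies in `G` and directs the
undirected edge `a - b` as `a → b`. -/
inductive MeekRule (G : PDGraph V) : V → V → Prop
  | r1 {a b c : V} : G.Undir a b → G.Dir c a → c ≠ b → ¬ G.Adj c b → MeekRule G a b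
  | r2 {a b c : V} : G.Undir a b → G.Dir a c → G.Dir c b → MeekRule G a b
  | r3 {a b c d : V} : G.Undir a b → G.Undir a c → G.Undir a d → G.Dir c b → G.Dir d b →
      c ≠ d → ¬ G.Adj c d → MeekRule G a b
  | r4 {a b c d : V} : G.Undir a b → G.Adj a c → G.Undir a d → G.Dir d c → G.Dir c b →
      d ≠ b → ¬ G.Adj d b → MeekRule G a b

/-- One application of an orientation rule. -/
def MeekStep (G H : PDGraph V) : Prop :=
  ∃ a b, G.MeekRule a b ∧ G.OrientedBy (fun u w => u = a ∧ w = b) H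

/-- `H` is obtained from `G` by applying the orientation rules until none of them applies. -/
def IsMeekCompletion (G H : PDGraph V) : Prop :=
  Relation.ReflTransGen MeekStep G H ∧ ∀ a b, ¬ H.MeekRule a b

/-- A maximally oriented PDAG: take a CPDAG `C`, direct some of its undirected edges according
to background knowledge `K` that is consistent with `C` (it agrees with at least one DAG
represented by `C`), and complete the orientation rules. -/
def IsMPDAG (G : PDGraph V) : Prop :=
  ∃ (C : PDGraph V) (K : V → V → Prop) (H : PDGraph V),
    C.IsCPDAG ∧ (∃ D, C.Represents D ∧ ∀ a b, K a b → D.Dir a b) ∧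
    C.OrientedBy K H ∧ H.IsMeekCompletion G

/-- `p` is a path with at least two nodes: the nodes are distinct and successive nodes are
adjacent. -/
def IsPath (G : PDGraph V) (p : List V) : Prop :=
  2 ≤ p.length ∧ p.Nodup ∧ p.IsChain G.Adj

/-- A possibly causal path `⟨V₁, …, V_k⟩`: `G` has no edge `V_i ← V_j` with `i < j`, whether or
not the two nodes are successive. -/
def IsPossiblyCausalPath (G : PDGraph V) (p : List V) : Prop :=
  G.IsPath p ∧ p.Pairwise (fun a b => ¬ G.Dir b a)

/-- The path runs from `X` to `Y`, and only its first node is in `X`. -/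
def IsProperFromTo (X Y : Finset V) (p : List V) : Prop :=
  ∃ x l y, p = x :: l ∧ x ∈ X ∧ (∀ w ∈ l, w ∉ X) ∧ p.getLast? = some y ∧ y ∈ Y

/-- The first edge of the path is undirected. -/
def StartsUndirected (G : PDGraph V) (p : List V) : Prop :=
  ∃ a b l, p = a :: b :: l ∧ G.Undir a b

open scoped Classical in
/-- The set of parents of a node. -/
noncomputable def parents [Fintype V] (G : PDGraph V) (i : V) : Finset V :=
  Finset.univ.filter (fun j => G.Dir j i)

end PDGraph

section Densities

variable {V : Type*} [Fintype V] [DecidableEq V]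

/-- The marginal of `f` over the variables in `S`: the variables outside `S` are integrated out.
It is a function of a full assignment `v` that depends only on the values of `v` on `S`. -/
noncomputable def marginalDensity (f : (V → ℝ) → ℝ≥0∞) (S : Finset V) : (V → ℝ) → ℝ≥0∞ :=
  lmarginal (fun _ => volume) Sᶜ f

/-- A strictly positive probability density (with respect to Lebesgue measure) of real random
variables indexed by `V`. -/
structure IsPositiveDensity (f : (V → ℝ) → ℝ≥0∞) : Prop where
  measurable : Measurable f
  pos : ∀ v, 0 < f v
  lt_top : ∀ v, f v < ∞
  lintegral_eq_one : ∫⁻ v, f v = 1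

/-- `q` is (a version of) the conditional density `f(v_i | v_S)`: a measurable function of the
values on `S ∪ {i}` which is a probability density in `v_i` for all values on `S`, and which
satisfies `f(v_i, v_S) = f(v_i | v_S) f(v_S)` almost everywhere. -/
structure IsCondDensity (f : (V → ℝ) → ℝ≥0∞) (i : V) (S : Finset V)
    (q : (V → ℝ) → ℝ≥0∞) : Prop where
  measurable : Measurable q
  dependsOn : DependsOn q (insert i S : Finset V)
  lintegral_eq_one : ∀ v, ∫⁻ t : ℝ, q (Function.update v i t) = 1
  marginal_eq : ∀ᵐ v : V → ℝ,
    marginalDensity f (insert i S) v = q v * marginalDensity f S v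

/-- A family of interventional densities: `F A a v` is `f(v | do(A = a))`. It is a density with
respect to Lebesgue measure in the variables outside `A`, with the variables in `A` fixed
at `a`. -/
abbrev InterventionalFamily (V : Type*) :=
  (A : Finset V) → (A → ℝ) → (V → ℝ) → ℝ≥0∞

/-- The observational density: no variable is intervened on. -/
def InterventionalFamily.obs (F : InterventionalFamily V) : (V → ℝ) → ℝ≥0∞ :=
  F ∅ isEmptyElim

open scoped Classical in
/-- The DAG `D`, were it causal, is a causal Bayesian network compatible with `F`: the truncated
factorization holds for all intervention sets `A` and all intervention values `a`, where the
factors are the conditional densities of the (strictly positive) observational density given the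
parents in `D`. For `A = ∅` this says that the observational density is Markov compatible
with `D`. -/
def PDGraph.Compatible (D : PDGraph V) (F : InterventionalFamily V) : Prop :=
  IsPositiveDensity F.obs ∧
  ∃ q : V → (V → ℝ) → ℝ≥0∞,
    (∀ i, IsCondDensity F.obs i (D.parents i) (q i)) ∧
    ∀ (A : Finset V) (a : A → ℝ) (v : V → ℝ),
      F A a v = if ∀ i : A, v i = a i then ∏ i ∈ Aᶜ, q i v else 0

/-- The conditional interventional density `f(y | do(x), z) = f(y, z | do(x)) / f(z | do(x))`,
where `x`, `y`, `z` are the values of the assignment `v` on `X`, `Y`, `Z`. -/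
noncomputable def InterventionalFamily.condEffect (F : InterventionalFamily V)
    (X Y Z : Finset V) (v : V → ℝ) : ℝ≥0∞ :=
  marginalDensity (F X (fun i => v i)) (X ∪ Y ∪ Z) v /
    marginalDensity (F X (fun i => v i)) (X ∪ Z) v

/-- The conditional causal effect of `X` on `Y` given `Z` is identifiable in `G`: if two families
of interventional densities, each compatible with a DAG represented by `G`, have the same
observational density, then they have the same `f(y | do(x), z)`. Conditional densities
are compared almost everywhere. -/
def PDGraph.Identifiable (G : PDGraph V) (X Y Z : Finset V) : Prop :=
  ∀ (D₁ D₂ : PDGraph V) (F₁ F₂ : InterventionalFamily V),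
    G.Represents D₁ → G.Represents D₂ → D₁.Compatible F₁ → D₂.Compatible F₂ →
    F₁.obs = F₂.obs →
    ∀ᵐ v : V → ℝ, F₁.condEffect X Y Z v = F₂.condEffect X Y Z v

end Densities

/-! Choose a shortest path of the given kind. Properness and possible causality pass to
subsequences, so minimality has three effects: only the last node lies in `Y`, the part after `x` is
unshielded, and `x` is not joined by an undirected edge to the node after `y`. Two DAGs of `[G]`
then direct the whole path after `y` forwards and disagree on `x - y` (`exists_represents_pair`).

These DAGs need an extension theorem for graphs closed under Meek's rules. A node outside an
undirected component that points into it points at every node of it, and no unshielded collider lies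
inside the component. Hence the component may be reoriented independently of the rest, by removing
simplicial sinks one at a time and ordering them from last to first
(`MeekClosed.exists_represents`). The combinatorial core is `MeekClosed.exists_isSimplicialSink`,
which leaves enough freedom in the choice of the sink to order a clique as desired or to make a node
a source for its undirected edges.

For the densities, take standard Gaussians that are independent except that consecutive path nodes
have signs of correlation `2⁻¹`. The coupling kernel is symmetric, so the same observational density
factorizes over both DAGs. Correlations multiply along a path (`lintegral_signKernel_mul`). Under
do(`X`), the first DAG leaves the end of the path correlated with the value of `x`, with correlation
a positive power of `2⁻¹`. In the second DAG the factor of `x` is deleted, and with it all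
dependence on `x`. The variables in `Z` are off the path and cancel, so the two effects differ at
every point. -/

namespace PDGraph

/-! ### Meek's rules: soundness and the structure of undirected components -/

section Orientation

variable {V : Type*} {G H D : PDGraph V} {a b c : V}

theorem Adj.symm (h : G.Adj a b) : G.Adj b a := by
  rcases h with h | h | h
  · exact Or.inr (Or.inl h)
  · exact Or.inl h
  · exact Or.inr (Or.inr (G.undir_symm _ _ h))

theorem Adj.ne (h : G.Adj a b) : a ≠ b := by
  rintro rfl
  rcases h with h | h | h
  · exact G.dir_asymm _ _ h h
  · exact G.dir_asymm _ _ h h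
  · exact G.undir_irrefl _ h

theorem adj_of_dir (h : G.Dir a b) : G.Adj a b := Or.inl h

theorem adj_of_undir (h : G.Undir a b) : G.Adj a b := Or.inr (Or.inr h)

theorem not_dir_of_undir (h : G.Undir a b) : ¬ G.Dir a b :=
  fun h' => G.not_undir_of_dir _ _ h' h

theorem not_dir_of_undir' (h : G.Undir a b) : ¬ G.Dir b a :=
  not_dir_of_undir (G.undir_symm _ _ h)

theorem IsDAG.dir_or_dir (hD : D.IsDAG) (h : D.Adj a b) : D.Dir a b ∨ D.Dir b a := by
  rcases h with h | h | h
  · exact Or.inl h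
  · exact Or.inr h
  · exact absurd h (hD.1 _ _)

theorem IsDAG.dir_trans (hD : D.IsDAG) (hab : D.Dir a b) (hbc : D.Dir b c) (h : D.Adj a c) :
    D.Dir a c :=
  (hD.dir_or_dir h).resolve_right fun hca =>
    hD.2 a (((Relation.TransGen.single hab).tail hbc).tail hca)

theorem Represents.adj_iff (h : G.Represents D) (a b : V) : G.Adj a b ↔ D.Adj a b := h.2.1.1 a b

theorem Represents.dir_or_dir (h : G.Represents D) (hab : G.Adj a b) : D.Dir a b ∨ D.Dir b a :=
  h.1.dir_or_dir ((h.adj_iff a b).1 hab)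

theorem Represents.dir_of_undir (h : G.Represents D) (hab : G.Undir a b) (hn : ¬ D.Dir b a) :
    D.Dir a b :=
  (h.dir_or_dir (adj_of_undir hab)).resolve_right hn

/-- The four orientation rules are sound. -/
theorem Represents.dir_of_meekRule (h : G.Represents D) (hr : G.MeekRule a b) : D.Dir a b := by
  -- A wrong orientation would give `D` an unshielded collider, hence one of `G`, that uses an edge
  -- undirected in `G`; or else a directed cycle.
  have key : ∀ {u w : V}, G.Undir u w → ∀ {e : V}, D.Dir e u → D.Dir w u → e ≠ w →
      ¬ G.Adj e w → False := by
    intro u w huw e heu hwu hne hadj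
    have hc : G.UnshieldedCollider e u w :=
      (h.2.1.2 e u w).2 ⟨heu, hwu, hne, fun h' => hadj ((h.adj_iff _ _).2 h')⟩
    exact not_dir_of_undir' huw hc.2.1
  have tr : ∀ {u w e : V}, D.Dir u w → D.Dir w e → G.Adj u e → D.Dir u e :=
    fun h₁ h₂ h₃ => h.1.dir_trans h₁ h₂ ((h.adj_iff _ _).1 h₃)
  by_contra hn
  cases hr with
  | r1 hab hca hne hadj =>
    exact key hab (h.2.2 _ _ hca) (h.dir_of_undir (G.undir_symm _ _ hab) hn) hne hadj
  | r2 hab hac hcb =>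
    exact hn (tr (h.2.2 _ _ hac) (h.2.2 _ _ hcb) (adj_of_undir hab))
  | r3 hab hac had hcb hdb hne hadj =>
    have hba := h.dir_of_undir (G.undir_symm _ _ hab) hn
    have hca := tr (h.2.2 _ _ hcb) hba (adj_of_undir hac).symm
    have hda := tr (h.2.2 _ _ hdb) hba (adj_of_undir had).symm
    exact key had hca hda hne hadj
  | r4 hab hac had hdc hcb hne hadj =>
    have hba := h.dir_of_undir (G.undir_symm _ _ hab) hn
    have hca := tr (h.2.2 _ _ hcb) hba hac.symm
    have hda := tr (h.2.2 _ _ hdc) hca (adj_of_undir had).symm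
    exact key hab hda hba hne hadj

theorem OrientedBy.adj_iff {K : V → V → Prop} (h : G.OrientedBy K H) (a b : V) :
    H.Adj a b ↔ G.Adj a b := by
  unfold Adj
  rw [h.2.1, h.2.1, h.2.2]
  have h₁ := h.1 a b
  have h₂ := fun hk => G.undir_symm _ _ (h.1 b a hk)
  tauto

theorem Represents.of_orientedBy {K : V → V → Prop} (h : G.Represents D)
    (ho : G.OrientedBy K H) (hK : ∀ a b, K a b → D.Dir a b) : H.Represents D := by
  have hadj : ∀ a b, H.Adj a b ↔ D.Adj a b := fun a b => (ho.adj_iff a b).trans (h.adj_iff a b)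
  have hdir : ∀ a b, H.Dir a b → D.Dir a b := fun a b hab =>
    ((ho.2.1 a b).1 hab).elim (h.2.2 a b) (hK a b)
  refine ⟨h.1, ⟨hadj, fun a b c => ⟨fun hc => ?_, fun hc => ?_⟩⟩, hdir⟩
  · exact ⟨hdir _ _ hc.1, hdir _ _ hc.2.1, hc.2.2.1, fun h' => hc.2.2.2 ((hadj _ _).2 h')⟩
  · have hG := (h.2.1.2 a b c).2 hc
    exact ⟨(ho.2.1 _ _).2 (Or.inl hG.1), (ho.2.1 _ _).2 (Or.inl hG.2.1), hc.2.2.1,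
      fun h' => hc.2.2.2 ((hadj _ _).1 h')⟩

/-- A DAG agreeing with the background knowledge survives every rule application by soundness. This
and closure under the rules are all that is used about MPDAGs. -/
theorem IsMPDAG.exists_represents (hG : G.IsMPDAG) : ∃ D, G.Represents D := by
  obtain ⟨C, K, H, -, ⟨D, hCD, hK⟩, hCH, hHG, -⟩ := hG
  refine ⟨D, ?_⟩
  have hHD : H.Represents D := hCD.of_orientedBy hCH hK
  induction hHG with
  | refl => exact hHD
  | tail _ hs ih =>
    obtain ⟨a, b, hr, ho⟩ := hs
    refine ih.of_orientedBy ho ?_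
    rintro _ _ ⟨rfl, rfl⟩
    exact ih.dir_of_meekRule hr

/-- None of the orientation rules applies. -/
def MeekClosed (G : PDGraph V) : Prop := ∀ a b, ¬ G.MeekRule a b

theorem IsMPDAG.meekClosed (hG : G.IsMPDAG) : G.MeekClosed := by
  obtain ⟨_, _, _, -, -, -, -, h⟩ := hG
  exact h

/-- R1 excludes non-adjacency of `a` and `c`, and R2 excludes `c → a`. -/
theorem MeekClosed.dir_or_undir (hG : G.MeekClosed) (hab : G.Dir a b) (hbc : G.Undir b c) :
    G.Dir a c ∨ G.Undir a c := by
  have hne : a ≠ c := by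
    rintro rfl
    exact not_dir_of_undir' hbc hab
  by_contra hn
  push Not at hn
  by_cases hca : G.Dir c a
  · exact hG c b (.r2 (G.undir_symm _ _ hbc) hca hab)
  · exact hG b c (.r1 hbc hab hne fun h => h.elim hn.1 fun h => h.elim hca hn.2)

/-- The arrow out of `a` moves along undirected edges: the alternative in `dir_or_undir` would put
`a` in the component. -/
theorem MeekClosed.dir_component (hG : G.MeekClosed) (hab : G.Dir a b)
    (hna : ¬ Relation.ReflTransGen G.Undir b a) (hbc : Relation.ReflTransGen G.Undir b c) :
    G.Dir a c := by
  induction hbc with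
  | refl => exact hab
  | tail hbc hcd ih =>
    refine (hG.dir_or_undir ih hcd).resolve_right fun h => hna ?_
    exact (hbc.tail hcd).tail (G.undir_symm _ _ h)

/-- The centre of the collider can be moved along undirected edges until it reaches `a`, which gives
a loop. In one move, R1 excludes that exactly one of the two arrows becomes undirected, and R3
excludes that both do. -/
theorem MeekClosed.not_unshieldedCollider (hG : G.MeekClosed)
    (hba : Relation.ReflTransGen G.Undir b a) : ¬ G.UnshieldedCollider a b c := by
  intro h
  suffices ∀ d, Relation.ReflTransGen G.Undir b d → G.UnshieldedCollider a d c from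
    (adj_of_dir (this a hba).1).ne rfl
  intro d hd
  induction hd with
  | refl => exact h
  | @tail e d _ hed ih =>
    obtain ⟨hae, hce, hne, hadj⟩ := ih
    have hadj' : ¬ G.Adj c a := fun h => hadj h.symm
    have hde := G.undir_symm _ _ hed
    rcases hG.dir_or_undir hae hed with had | had <;> rcases hG.dir_or_undir hce hed with hcd | hcd
    · exact ⟨had, hcd, hne, hadj⟩
    · exact (hG d c (.r1 (G.undir_symm _ _ hcd) had hne hadj)).elim
    · exact (hG d a (.r1 (G.undir_symm _ _ had) hcd hne.symm hadj')).elim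
    · exact (hG d e (.r3 hde (G.undir_symm _ _ had) (G.undir_symm _ _ hcd) hae hce hne hadj)).elim

open scoped Classical in
theorem Acyclic.exists_rank [Fintype V] (hD : D.Acyclic) :
    ∃ r : V → ℕ, ∀ a b, D.Dir a b → r a < r b := by
  refine ⟨fun a => (Finset.univ.filter fun w => Relation.TransGen D.Dir w a).card,
    fun a b hab => Finset.card_lt_card ?_⟩
  rw [Finset.ssubset_iff_of_subset]
  · exact ⟨a, by simpa using Relation.TransGen.single hab, by simpa using hD a⟩
  · intro w hw
    simp only [Finset.mem_filter, Finset.mem_univ, true_and] at hw ⊢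
    exact hw.tail hab

end Orientation

/-! ### Simplicial sinks and elimination orders -/

section Elimination

variable {V : Type*} {G D : PDGraph V}

/-- In the subgraph induced by `S`, no directed edge leaves `v` and the neighbours of `v` are
pairwise adjacent. -/
def IsSimplicialSink (G : PDGraph V) (S : Finset V) (v : V) : Prop :=
  v ∈ S ∧ (∀ w ∈ S, ¬ G.Dir v w) ∧
    ∀ w ∈ S, ∀ w' ∈ S, G.Adj v w → G.Adj v w' → w ≠ w' → G.Adj w w'

theorem IsSimplicialSink.of_erase [DecidableEq V] {S : Finset V} {s v : V}
    (h : G.IsSimplicialSink (S.erase s) v) (hs : ¬ G.Adj v s) : G.IsSimplicialSink S v := by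
  have mem : ∀ w ∈ S, G.Adj v w → w ∈ S.erase s := fun w hw hvw =>
    Finset.mem_erase.2 ⟨fun h => hs (h ▸ hvw), hw⟩
  refine ⟨Finset.mem_of_mem_erase h.1, fun w hw hd => ?_, fun w hw w' hw' ha ha' => ?_⟩
  · exact h.2.1 w (mem w hw (adj_of_dir hd)) hd
  · exact h.2.2 w (mem w hw ha) w' (mem w' hw' ha') ha ha'

open scoped Classical in
/-- A clique `K` of a Meek-closed graph without unshielded colliders may be eliminated last,
apart from a prescribed node `t` of `K` which has no directed edge into `K`. -/
theorem MeekClosed.exists_isSimplicialSink [Fintype V] (hG : G.MeekClosed) (hD : G.Represents D)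
    (S : Finset V) (hS : ∀ a ∈ S, ∀ b ∈ S, ∀ c ∈ S, ¬ G.UnshieldedCollider a b c)
    (K : Finset V) (hKS : K ⊆ S) (hK : ∀ a ∈ K, ∀ b ∈ K, a ≠ b → G.Adj a b)
    (t : V) (ht : t ∈ K) (htK : ∀ k ∈ K, ¬ G.Dir t k) :
    ∃ v, G.IsSimplicialSink S v ∧ (v ∉ K ∨ v = t) := by
  induction S using Finset.strongInduction generalizing K t with
  | H S ih =>
  obtain ⟨r, hr⟩ := hD.1.2.exists_rank
  -- The last node of `S` in the order of `D` is a simplicial sink, because `S` contains no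
  -- unshielded collider. Work remains only if it lies in `K` and is not `t`.
  obtain ⟨s, hsS, hsmax⟩ := S.exists_max_image r ⟨t, hKS ht⟩
  have hsout : ∀ w ∈ S, ¬ D.Dir s w := fun w hw h => (hr _ _ h).not_ge (hsmax w hw)
  have hsin : ∀ w ∈ S, G.Adj s w → D.Dir w s := fun w hw h =>
    (hD.dir_or_dir h).resolve_left (hsout w hw)
  have hsclique : ∀ w ∈ S, ∀ w' ∈ S, G.Adj s w → G.Adj s w' → w ≠ w' → G.Adj w w' := by
    intro w hw w' hw' h h' hne
    by_contra hn
    exact hS w hw s hsS w' hw' ((hD.2.1.2 w s w').2 ⟨hsin w hw h, hsin w' hw' h', hne,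
      fun h'' => hn ((hD.adj_iff _ _).2 h'')⟩)
  have hssink : G.IsSimplicialSink S s := ⟨hsS, fun w hw h => hsout w hw (hD.2.2 _ _ h), hsclique⟩
  by_cases hst : s ∉ K ∨ s = t
  · exact ⟨s, hssink, hst⟩
  push Not at hst
  obtain ⟨hsK, hst⟩ := hst
  -- The clique is enlarged to the closed neighbourhood of `s`, so that nodes outside it are not
  -- adjacent to `s` and sinks of `S.erase s` outside it remain simplicial sinks of `S`.
  set L : Finset V := S.filter fun w => w = s ∨ G.Adj s w with hL
  have memL : ∀ w, w ∈ L ↔ w ∈ S ∧ (w = s ∨ G.Adj s w) := fun w => by simp [hL]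
  have hKL : K ⊆ L := fun k hk => (memL k).2 ⟨hKS hk, by
    by_cases h : k = s
    · exact Or.inl h
    · exact Or.inr (hK s hsK k hk (Ne.symm h))⟩
  have hLclique : ∀ a ∈ L, ∀ b ∈ L, a ≠ b → G.Adj a b := by
    intro a ha b hb hne
    obtain ⟨haS, ha⟩ := (memL a).1 ha
    obtain ⟨hbS, hb⟩ := (memL b).1 hb
    rcases ha with rfl | ha <;> rcases hb with rfl | hb
    · exact absurd rfl hne
    · exact hb
    · exact ha.symm
    · exact hsclique a haS b hbS ha hb hne
  -- The prescribed node must have no arrow into the larger clique. If `t` fails, its `D`-last child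
  -- in `L` serves: by R2 a child of that node would again be a child of `t`.
  obtain ⟨u, huL, huout, hut⟩ : ∃ u ∈ L, (∀ k ∈ L, ¬ G.Dir u k) ∧ (u ∉ K ∨ u = t) := by
    by_cases htL : ∀ k ∈ L, ¬ G.Dir t k
    · exact ⟨t, hKL ht, htL, Or.inr rfl⟩
    push Not at htL
    obtain ⟨k, hkL, htk⟩ := htL
    obtain ⟨u, hu, humax⟩ := (L.filter fun k => G.Dir t k).exists_max_image r
      ⟨k, Finset.mem_filter.2 ⟨hkL, htk⟩⟩
    obtain ⟨huL, htu⟩ := Finset.mem_filter.1 hu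
    refine ⟨u, huL, fun k hk huk => ?_, Or.inl fun huK => htK u huK htu⟩
    have hDtk := ((Relation.TransGen.single (hD.2.2 _ _ htu)).tail (hD.2.2 _ _ huk))
    have hne : t ≠ k := by
      rintro rfl
      exact hD.1.2 _ hDtk
    have htk : G.Dir t k := by
      rcases hLclique t (hKL ht) k hk hne with h | h | h
      · exact h
      · exact absurd (hDtk.tail (hD.2.2 _ _ h)) (hD.1.2 _)
      · exact absurd (MeekRule.r2 h htu huk) (hG _ _)
    exact (hr _ _ (hD.2.2 _ _ huk)).not_ge (humax k (Finset.mem_filter.2 ⟨hk, htk⟩))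
  have hus : u ≠ s := by
    rintro rfl
    exact hut.elim (fun h => h hsK) hst
  have huS := ((memL u).1 huL).1
  suffices ∃ v, G.IsSimplicialSink S v ∧ (v ∉ L ∨ v = u) by
    obtain ⟨v, hv, h⟩ := this
    exact ⟨v, hv, h.elim (fun h => Or.inl fun hvK => h (hKL hvK)) fun h => h ▸ hut⟩
  have hsL : s ∈ L := hKL hsK
  have hus' : G.Undir u s := by
    rcases hLclique u huL s hsL hus with h | h | h
    · exact absurd h (huout s hsL)
    · exact absurd h (hssink.2.1 u huS)
    · exact h
  have hlt := Finset.erase_ssubset hsS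
  have hS' : ∀ a ∈ S.erase s, ∀ b ∈ S.erase s, ∀ c ∈ S.erase s, ¬ G.UnshieldedCollider a b c :=
    fun a ha b hb c hc => hS a (Finset.mem_of_mem_erase ha) b (Finset.mem_of_mem_erase hb) c
      (Finset.mem_of_mem_erase hc)
  have lift : ∀ v, G.IsSimplicialSink (S.erase s) v → v ∉ L → G.IsSimplicialSink S v :=
    fun v hv hvL => hv.of_erase fun h =>
      hvL ((memL v).2 ⟨Finset.mem_of_mem_erase hv.1, Or.inr h.symm⟩)
  have hLS : L.erase s ⊆ S.erase s := Finset.erase_subset_erase s (Finset.filter_subset _ _)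
  have huL' : u ∈ L.erase s := Finset.mem_erase.2 ⟨hus, huL⟩
  obtain ⟨v, hv, hvu⟩ := ih (S.erase s) hlt hS' (L.erase s) hLS
    (fun a ha b hb => hLclique a (Finset.mem_of_mem_erase ha) b (Finset.mem_of_mem_erase hb))
    u huL' (fun k hk => huout k (Finset.mem_of_mem_erase hk))
  rcases hvu with hvL | rfl
  · have hvL' : v ∉ L := fun h => hvL (Finset.mem_erase.2 ⟨Finset.ne_of_mem_erase hv.1, h⟩)
    exact ⟨v, lift v hv hvL', Or.inl hvL'⟩
  -- The sink found in `S.erase s` may be `u` itself, which is adjacent to `s`. It stays simplicial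
  -- in `S` unless it has a neighbour `q` outside `L`.
  by_cases hN : ∀ w ∈ S, G.Adj v w → w = s ∨ G.Adj s w
  · refine ⟨v, ⟨huS, fun w hw h => ?_, fun w hw w' hw' h h' hne => ?_⟩, Or.inr rfl⟩
    · exact huout w ((memL w).2 ⟨hw, hN w hw (adj_of_dir h)⟩) h
    · exact hLclique w ((memL w).2 ⟨hw, hN w hw h⟩) w' ((memL w').2 ⟨hw', hN w' hw' h'⟩) hne
  push Not at hN
  obtain ⟨q, hqS, hvq, hqs, hsq⟩ := hN
  have hqS' : q ∈ S.erase s := Finset.mem_erase.2 ⟨hqs, hqS⟩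
  have hqL : q ∉ L := fun h => ((memL q).1 h).2.elim hqs hsq
  have hvq' : G.Undir v q := by
    rcases hvq with h | h | h
    · exact absurd h (hv.2.1 q hqS')
    · exact absurd (MeekRule.r1 hus' h hqs fun h' => hsq h'.symm) (hG _ _)
    · exact h
  have hqk : ∀ k ∈ L.erase s, G.Adj q k := by
    intro k hk
    have hne : q ≠ k := fun h => hqL (h ▸ Finset.mem_of_mem_erase hk)
    by_cases hkv : k = v
    · exact hkv ▸ hvq.symm
    · exact hv.2.2 q hqS' k (hLS hk) hvq
        (hLclique v huL k (Finset.mem_of_mem_erase hk) (Ne.symm hkv)) hne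
  -- An arrow from `q` to `k` would direct `v - s` by R4 if `k → s`, and `k - s` by R1 otherwise. So
  -- `q` can be the prescribed node of the clique `insert q (L.erase s)`, and the sink then obtained
  -- avoids `L`.
  have hqout : ∀ k ∈ L.erase s, ¬ G.Dir q k := by
    intro k hk h
    have hkS := Finset.mem_of_mem_erase (hLS hk)
    have hkv : v ≠ k := by
      rintro rfl
      exact not_dir_of_undir' hvq' h
    rcases hLclique k (Finset.mem_of_mem_erase hk) s hsL (Finset.ne_of_mem_erase hk) with
      h' | h' | h'
    · exact hG v s (.r4 hus' (hLclique v huL k (Finset.mem_of_mem_erase hk) hkv) hvq' h h' hqs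
        fun h'' => hsq h''.symm)
    · exact hssink.2.1 k hkS h'
    · exact hG k s (.r1 h' h hqs fun h'' => hsq h''.symm)
  obtain ⟨w, hw, hwq⟩ := ih (S.erase s) hlt hS' (insert q (L.erase s))
    (Finset.insert_subset hqS' hLS) (by
      intro a ha b hb hne
      rcases Finset.mem_insert.1 ha with haq | haL <;> rcases Finset.mem_insert.1 hb with hbq | hbL
      · exact absurd (haq.trans hbq.symm) hne
      · exact haq ▸ hqk b hbL
      · exact hbq ▸ (hqk a haL).symm
      · exact hLclique a (Finset.mem_of_mem_erase haL) b (Finset.mem_of_mem_erase hbL) hne)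
    q (Finset.mem_insert_self _ _) (by
      intro k hk h
      rcases Finset.mem_insert.1 hk with rfl | hk
      · exact (adj_of_dir h).ne rfl
      · exact hqout k hk h)
  have hwL : w ∉ L := by
    rcases hwq with h | rfl
    · exact fun h' => h (Finset.mem_insert_of_mem
        (Finset.mem_erase.2 ⟨Finset.ne_of_mem_erase hw.1, h'⟩))
    · exact hqL
  exact ⟨w, lift w hw hwL, Or.inl hwL⟩

-- Each removed sink is ranked above all nodes that remain. Its earlier neighbours form a clique, so
-- orienting by rank creates no unshielded collider.
open scoped Classical in
theorem exists_elimination_order (R : V → V → Prop) (B : Finset V)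
    (h : ∀ S ⊆ B, S.Nonempty → ∃ v, G.IsSimplicialSink S v ∧ ∀ w ∈ S, ¬ R v w) :
    ∃ r : V → ℕ, Set.InjOn r B ∧ (∀ a ∈ B, ∀ b ∈ B, G.Dir a b ∨ R a b → r a < r b) ∧
      ∀ a ∈ B, ∀ b ∈ B, ∀ c ∈ B, r a < r b → r c < r b → G.Adj a b → G.Adj c b → a ≠ c →
        G.Adj a c := by
  induction B using Finset.strongInduction with
  | H B ih =>
  rcases B.eq_empty_or_nonempty with rfl | hB
  · exact ⟨fun _ => 0, by simp, by simp, by simp⟩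
  obtain ⟨v, hv, hvR⟩ := h B subset_rfl hB
  obtain ⟨r, hinj, hdir, hcl⟩ := ih (B.erase v) (Finset.erase_ssubset hv.1)
    fun S hS => h S (hS.trans (Finset.erase_subset _ _))
  have hlt : ∀ w ∈ B, w ≠ v → r w < B.sup r + 1 := fun w hw _ =>
    Nat.lt_succ_of_le (Finset.le_sup hw)
  have me : ∀ {w}, w ∈ B → w ≠ v → w ∈ B.erase v := fun hw hne => Finset.mem_erase.2 ⟨hne, hw⟩
  refine ⟨Function.update r v (B.sup r + 1), ?_, ?_, ?_⟩
  · intro a ha b hb hab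
    by_cases hav : a = v <;> by_cases hbv : b = v
    · rw [hav, hbv]
    · subst hav
      simp only [Function.update_self, Function.update_of_ne hbv] at hab
      exact absurd hab (hlt b hb hbv).ne'
    · subst hbv
      simp only [Function.update_self, Function.update_of_ne hav] at hab
      exact absurd hab (hlt a ha hav).ne
    · simp only [Function.update_of_ne hav, Function.update_of_ne hbv] at hab
      exact hinj (me ha hav) (me hb hbv) hab
  · intro a ha b hb hab
    have hav : a ≠ v := by
      rintro rfl
      exact hab.elim (hv.2.1 b hb) (hvR b hb)
    rw [Function.update_of_ne hav]
    by_cases hbv : b = v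
    · subst hbv
      simpa using hlt a ha hav
    · rw [Function.update_of_ne hbv]
      exact hdir a (me ha hav) b (me hb hbv) hab
  · intro a ha b hb c hc hab hcb hadj hadj' hne
    by_cases hbv : b = v
    · subst hbv
      exact hv.2.2 a ha c hc hadj.symm hadj'.symm hne
    rw [Function.update_of_ne hbv] at hab hcb
    have key : ∀ {w}, w ∈ B → Function.update r v (B.sup r + 1) w < r b → w ≠ v := by
      rintro w hw hlt' rfl
      rw [Function.update_self] at hlt'
      exact (hlt'.trans (hlt b hb hbv)).false
    have hav := key ha hab
    have hcv := key hc hcb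
    rw [Function.update_of_ne hav] at hab
    rw [Function.update_of_ne hcv] at hcb
    exact hcl a (me ha hav) b (me hb hbv) c (me hc hcv) hab hcb hadj hadj' hne

end Elimination

end PDGraph

namespace PDGraph

/-! ### Reorienting an undirected component -/

section Extension

variable {V : Type*} {G D : PDGraph V}

/-- Being joined by a path of undirected edges. -/
def UndirConnected (G : PDGraph V) : V → V → Prop := Relation.ReflTransGen G.Undir

theorem UndirConnected.symm {a b : V} (h : G.UndirConnected a b) : G.UndirConnected b a := by
  induction h with
  | refl => exact .refl
  | tail _ hbc ih => exact Relation.ReflTransGen.head (G.undir_symm _ _ hbc) ih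

theorem UndirConnected.trans {a b c : V} (h : G.UndirConnected a b) (h' : G.UndirConnected b c) :
    G.UndirConnected a c := Relation.ReflTransGen.trans h h'

theorem undirConnected_of_undir {a b : V} (h : G.Undir a b) : G.UndirConnected a b :=
  Relation.ReflTransGen.single h

open scoped Classical in
/-- `D` with the edges inside `B` reoriented by increasing `r`. -/
def reorient (D : PDGraph V) (_ : D.IsDAG) (B : V → Prop) (r : V → ℕ) : PDGraph V where
  Dir a b := if B a ∧ B b then D.Adj a b ∧ r a < r b else D.Dir a b
  Undir _ _ := False
  dir_asymm a b h h' := by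
    by_cases hB : B a ∧ B b
    · rw [if_pos hB] at h
      rw [if_pos hB.symm] at h'
      exact h.2.asymm h'.2
    · rw [if_neg hB] at h
      rw [if_neg fun h => hB h.symm] at h'
      exact D.dir_asymm _ _ h h'
  undir_symm _ _ h := h
  undir_irrefl _ h := h
  not_undir_of_dir _ _ _ h := h

section

variable {hD : D.IsDAG} {B : V → Prop} {r : V → ℕ} {a b : V}

theorem reorient_dir_of_mem (ha : B a) (hb : B b) :
    (D.reorient hD B r).Dir a b ↔ D.Adj a b ∧ r a < r b := by
  simp [reorient, ha, hb]

theorem reorient_dir_of_not (h : ¬ (B a ∧ B b)) :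
    (D.reorient hD B r).Dir a b ↔ D.Dir a b := by
  simp only [reorient, if_neg h]

theorem reorient_adj (hr : ∀ a b, B a → B b → r a = r b → a = b) :
    (D.reorient hD B r).Adj a b ↔ D.Adj a b := by
  by_cases h : B a ∧ B b
  · have h' : ∀ x : Prop, (x ∨ (D.reorient hD B r).Undir a b) ↔ x := fun x => by simp [reorient]
    unfold Adj
    rw [h', reorient_dir_of_mem h.1 h.2, reorient_dir_of_mem h.2 h.1]
    constructor
    · rintro (h | h)
      · exact h.1
      · exact h.1.symm
    · intro hab
      rcases lt_trichotomy (r a) (r b) with hlt | heq | hlt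
      · exact Or.inl ⟨hab, hlt⟩
      · exact absurd (hr a b h.1 h.2 heq) (Adj.ne hab)
      · exact Or.inr ⟨Adj.symm hab, hlt⟩
  · unfold Adj
    rw [reorient_dir_of_not h, reorient_dir_of_not fun h' => h h'.symm]
    have h₁ : ¬ (D.reorient hD B r).Undir a b := id
    have h₂ := hD.1 a b
    tauto

/-- A stretch of a walk inside `B` that was entered from outside can be short-circuited, since the
entering node is a `D`-parent of all of `B`. A cycle through a node outside `B` thus yields a cycle
of `D`, and a cycle within `B` would increase `r`. -/
theorem reorient_isDAG (hB : ∀ a b c, ¬ B a → B b → B c → D.Dir a b → D.Dir a c) :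
    (D.reorient hD B r).IsDAG := by
  refine ⟨fun _ _ h => h, ?_⟩
  have out : ∀ a c, ¬ B a → Relation.TransGen (D.reorient hD B r).Dir a c →
      Relation.TransGen D.Dir a c ∧ (B c → ∀ b, B b → Relation.TransGen D.Dir a b) := by
    intro a c ha h
    induction h with
    | single h =>
      rw [reorient_dir_of_not fun h => ha h.1] at h
      exact ⟨.single h, fun hc b hb => .single (hB _ _ _ ha hc hb h)⟩
    | @tail c d _ hcd ih =>
      by_cases hc : B c
      · by_cases hd : B d
        · exact ⟨ih.2 hc d hd, fun _ => ih.2 hc⟩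
        · rw [reorient_dir_of_not fun h => hd h.2] at hcd
          exact ⟨ih.1.tail hcd, fun h => absurd h hd⟩
      · rw [reorient_dir_of_not fun h => hc h.1] at hcd
        exact ⟨ih.1.tail hcd, fun hd b hb => ih.1.tail (hB _ _ _ hc hd hb hcd)⟩
  have acyc : ∀ a, ¬ B a → ¬ Relation.TransGen (D.reorient hD B r).Dir a a :=
    fun a ha h => hD.2 a (out a a ha h).1
  intro a h
  by_cases ha : B a
  · have : ∀ c, Relation.TransGen (D.reorient hD B r).Dir a c → (B c ∧ r a < r c) ∨
        ∃ e, ¬ B e ∧ Relation.TransGen (D.reorient hD B r).Dir a e ∧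
          Relation.ReflTransGen (D.reorient hD B r).Dir e c := by
      intro c hc
      induction hc with
      | @single c hc =>
        by_cases hBc : B c
        · exact Or.inl ⟨hBc, ((reorient_dir_of_mem ha hBc).1 hc).2⟩
        · exact Or.inr ⟨c, hBc, .single hc, .refl⟩
      | @tail c d hac hcd ih =>
        rcases ih with ⟨hc, hlt⟩ | ⟨e, he, hae, hec⟩
        · by_cases hd : B d
          · exact Or.inl ⟨hd, hlt.trans ((reorient_dir_of_mem hc hd).1 hcd).2⟩
          · exact Or.inr ⟨d, hd, hac.tail hcd, .refl⟩
        · exact Or.inr ⟨e, he, hae, hec.tail hcd⟩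
    rcases this a h with ⟨-, h⟩ | ⟨e, he, hae, hea⟩
    · exact h.false
    · exact acyc e he (Relation.TransGen.trans_right hea hae)
  · exact acyc a ha h

end

open scoped Classical in
/-- An orientation of the edges of an undirected component which can be obtained by eliminating
simplicial sinks extends to a represented DAG. -/
theorem MeekClosed.exists_represents [Fintype V] (hG : G.MeekClosed) (hD : G.Represents D) (u : V)
    (R : V → V → Prop)
    (h : ∀ S : Finset V, (∀ w ∈ S, G.UndirConnected u w) → S.Nonempty →
      ∃ v, G.IsSimplicialSink S v ∧ ∀ w ∈ S, ¬ R v w) :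
    ∃ D', G.Represents D' ∧ ∀ a b, G.UndirConnected u a → G.UndirConnected u b → G.Adj a b →
      R a b → D'.Dir a b := by
  obtain ⟨r, hinj, hdir, hcl⟩ := exists_elimination_order R
    (Finset.univ.filter fun w => G.UndirConnected u w)
    (fun S hS => h S fun w hw => (Finset.mem_filter.1 (hS hw)).2)
  simp only [Finset.mem_filter, Finset.mem_univ, true_and] at hdir hcl
  set B : V → Prop := fun w => G.UndirConnected u w with hB
  have hinj' : ∀ a b, B a → B b → r a = r b → a = b := fun a b ha hb hab =>
    hinj (by simpa using ha) (by simpa using hb) hab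
  have conn : ∀ {a b}, B a → B b → G.UndirConnected a b := fun ha hb =>
    UndirConnected.trans (UndirConnected.symm ha) hb
  have cross : ∀ a b, ¬ B a → B b → D.Dir a b → G.Dir a b := by
    intro a b ha hb hab
    rcases (hD.adj_iff a b).2 (adj_of_dir hab) with h | h | h
    · exact h
    · exact absurd (hD.2.2 _ _ h) (D.dir_asymm _ _ hab)
    · exact absurd (UndirConnected.trans hb (undirConnected_of_undir (G.undir_symm _ _ h))) ha
  -- This excludes mixed new colliders: a parent outside `B` is adjacent to every node of `B`, so
  -- the collider would be shielded.
  have into : ∀ a b c, ¬ B a → B b → B c → D.Dir a b → G.Dir a c := fun a b c ha hb hc hab =>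
    hG.dir_component (cross a b ha hb hab) (fun h => ha (UndirConnected.trans hb h)) (conn hb hc)
  have hadj : ∀ a b, (D.reorient hD.1 B r).Adj a b ↔ D.Adj a b := fun a b => reorient_adj hinj'
  have hsub : ∀ a b, G.Dir a b → (D.reorient hD.1 B r).Dir a b := by
    intro a b hab
    by_cases hB : B a ∧ B b
    · rw [reorient_dir_of_mem hB.1 hB.2]
      exact ⟨(hD.adj_iff _ _).1 (adj_of_dir hab), hdir a hB.1 b hB.2 (Or.inl hab)⟩
    · rw [reorient_dir_of_not hB]
      exact hD.2.2 _ _ hab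
  refine ⟨D.reorient hD.1 B r, ⟨reorient_isDAG fun a b c ha hb hc hab =>
    hD.2.2 _ _ (into a b c ha hb hc hab), ⟨fun a b => (hD.adj_iff a b).trans (hadj a b).symm,
    fun a b c => ⟨fun hc => ⟨hsub _ _ hc.1, hsub _ _ hc.2.1, hc.2.2.1, fun h =>
      hc.2.2.2 ((hD.adj_iff _ _).2 ((hadj _ _).1 h))⟩, ?_⟩⟩, hsub⟩, ?_⟩
  · rintro ⟨hab, hcb, hne, hnadj⟩
    rw [hadj] at hnadj
    have toG : D.Dir a b → D.Dir c b → G.UnshieldedCollider a b c := fun h h' =>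
      (hD.2.1.2 a b c).2 ⟨h, h', hne, hnadj⟩
    by_cases hb : B b
    · by_cases ha : B a <;> by_cases hc : B c
      · rw [reorient_dir_of_mem ha hb] at hab
        rw [reorient_dir_of_mem hc hb] at hcb
        exact absurd ((hD.adj_iff _ _).1 (hcl a ha b hb c hc hab.2 hcb.2
          ((hD.adj_iff _ _).2 hab.1) ((hD.adj_iff _ _).2 hcb.1) hne)) hnadj
      · rw [reorient_dir_of_not fun h => hc h.1] at hcb
        exact absurd (adj_of_dir (hD.2.2 _ _ (into c b a hc hb ha hcb))).symm hnadj
      · rw [reorient_dir_of_not fun h => ha h.1] at hab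
        exact absurd (adj_of_dir (hD.2.2 _ _ (into a b c ha hb hc hab))) hnadj
      · rw [reorient_dir_of_not fun h => ha h.1] at hab
        rw [reorient_dir_of_not fun h => hc h.1] at hcb
        exact toG hab hcb
    · rw [reorient_dir_of_not fun h => hb h.2] at hab hcb
      exact toG hab hcb
  · intro a b ha hb hab hR
    rw [reorient_dir_of_mem ha hb]
    exact ⟨(hD.adj_iff _ _).1 hab, hdir a ha b hb (Or.inr hR)⟩

theorem MeekClosed.not_unshieldedCollider_of_component (hG : G.MeekClosed) {u : V} {S : Finset V}
    (hS : ∀ w ∈ S, G.UndirConnected u w) :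
    ∀ a ∈ S, ∀ b ∈ S, ∀ c ∈ S, ¬ G.UnshieldedCollider a b c := fun a ha b hb _ _ =>
  hG.not_unshieldedCollider ((hS b hb).symm.trans (hS a ha))

open scoped Classical in
/-- Every ordering of a clique of an undirected component which is consistent with the directed
edges is realised by a represented DAG. -/
theorem MeekClosed.exists_represents_of_clique [Fintype V] (hG : G.MeekClosed) (hD : G.Represents D) (u : V)
    (K : Finset V) (hKu : ∀ k ∈ K, G.UndirConnected u k)
    (hK : ∀ a ∈ K, ∀ b ∈ K, a ≠ b → G.Adj a b) (f : V → ℕ)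
    (hf : ∀ a ∈ K, ∀ b ∈ K, f a ≤ f b → ¬ G.Dir b a) :
    ∃ D', G.Represents D' ∧ ∀ a ∈ K, ∀ b ∈ K, f a < f b → D'.Dir a b := by
  obtain ⟨D', hD', h⟩ := hG.exists_represents hD u (fun a b => a ∈ K ∧ b ∈ K ∧ f a < f b) (by
    intro S hS hne
    have hmoral := hG.not_unshieldedCollider_of_component hS
    rcases (S ∩ K).eq_empty_or_nonempty with hSK | hSK
    · obtain ⟨s, hs⟩ := hne
      obtain ⟨v, hv, -⟩ := hG.exists_isSimplicialSink hD S hmoral {s} (by simpa using hs)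
        (by simp +contextual) s (by simp)
        (fun k hk h => (adj_of_dir h).ne (Finset.mem_singleton.1 hk).symm)
      exact ⟨v, hv, fun w _ hw => Finset.eq_empty_iff_forall_notMem.1 hSK v
        (Finset.mem_inter.2 ⟨hv.1, hw.1⟩)⟩
    -- Among the clique nodes still present, only the one that is last for `f` may be removed.
    · obtain ⟨t, ht, htmax⟩ := (S ∩ K).exists_max_image f hSK
      have mem : ∀ {k}, k ∈ S ∩ K → k ∈ K := fun h => Finset.mem_of_mem_inter_right h
      obtain ⟨v, hv, hvt⟩ := hG.exists_isSimplicialSink hD S hmoral (S ∩ K)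
        Finset.inter_subset_left (fun a ha b hb => hK a (mem ha) b (mem hb)) t ht
        (fun k hk => hf k (mem hk) t (mem ht) (htmax k hk))
      refine ⟨v, hv, fun w hw hR => ?_⟩
      rcases hvt with h | rfl
      · exact h (Finset.mem_inter.2 ⟨hv.1, hR.1⟩)
      · exact (htmax w (Finset.mem_inter.2 ⟨hw, hR.2.1⟩)).not_gt hR.2.2)
  refine ⟨D', hD', fun a ha b hb hlt => h a b (hKu a ha) (hKu b hb) (hK a ha b hb ?_) ⟨ha, hb, hlt⟩⟩
  rintro rfl
  exact hlt.false

open scoped Classical in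
/-- All undirected edges at a node can be oriented away from it. -/
theorem MeekClosed.exists_represents_source [Fintype V] (hG : G.MeekClosed) (hD : G.Represents D) (u : V) :
    ∃ D', G.Represents D' ∧ ∀ w, G.Undir u w → D'.Dir u w := by
  obtain ⟨D', hD', h⟩ := hG.exists_represents hD u (fun a b => a = u ∧ G.Undir u b) (by
    intro S hS hne
    have hmoral := hG.not_unshieldedCollider_of_component hS
    by_cases hw : u ∈ S ∧ ∃ w ∈ S, G.Undir u w
    · obtain ⟨hu, w, hw, huw⟩ := hw
      obtain ⟨v, hv, hvw⟩ := hG.exists_isSimplicialSink hD S hmoral {u, w}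
        (by simp [Finset.insert_subset_iff, hu, hw])
        (by
          intro a ha b hb hne
          simp only [Finset.mem_insert, Finset.mem_singleton] at ha hb
          rcases ha with rfl | rfl <;> rcases hb with rfl | rfl
          · exact absurd rfl hne
          · exact adj_of_undir huw
          · exact (adj_of_undir huw).symm
          · exact absurd rfl hne) w (by simp) (by
          intro k hk h
          simp only [Finset.mem_insert, Finset.mem_singleton] at hk
          rcases hk with rfl | rfl
          · exact not_dir_of_undir' huw h
          · exact (adj_of_dir h).ne rfl)
      refine ⟨v, hv, fun w' _ hR => ?_⟩
      obtain ⟨rfl, -⟩ := hR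
      rcases hvw with h | rfl
      · simp at h
      · exact G.undir_irrefl _ huw
    · obtain ⟨s, hs⟩ := hne
      obtain ⟨v, hv, -⟩ := hG.exists_isSimplicialSink hD S hmoral {s} (by simpa using hs)
        (by simp +contextual) s (by simp)
        (fun k hk h => (adj_of_dir h).ne (Finset.mem_singleton.1 hk).symm)
      exact ⟨v, hv, fun w hwS hR => hw ⟨hR.1 ▸ hv.1, w, hwS, hR.2⟩⟩)
  exact ⟨D', hD', fun w huw => h u w .refl (undirConnected_of_undir huw) (adj_of_undir huw)
    ⟨rfl, huw⟩⟩

end Extension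

/-! ### Minimal paths and the two DAGs -/

section Paths

variable {V : Type*} {G D : PDGraph V}

/-- An edge into an unshielded possibly causal path orients the whole path. -/
theorem Represents.isChain_dir (hD : G.Represents D) {l : List V} {a b : V} (hab : D.Dir a b)
    (hadj : (a :: b :: l).IsChain G.Adj) (hpc : (a :: b :: l).Pairwise fun a b => ¬ G.Dir b a)
    (hun : ∀ u v w, [u, v, w] <:+: a :: b :: l → ¬ G.Adj u w) (hnd : (a :: b :: l).Nodup) :
    (a :: b :: l).IsChain D.Dir := by
  induction l generalizing a b with
  | nil => simpa using hab
  | cons c l ih =>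
    refine List.isChain_cons_cons.2 ⟨hab, ih ?_ hadj.tail hpc.tail
      (fun u v w h => hun u v w (h.trans (List.suffix_cons _ _).isInfix)) hnd.tail⟩
    have hac : ¬ G.Adj a c := hun a b c ⟨[], l, by simp⟩
    have hbc : G.Adj b c := (List.isChain_cons_cons.1 hadj.tail).1
    refine (hD.dir_or_dir hbc).resolve_right fun hcb => ?_
    have hne : a ≠ c := by
      rintro rfl
      simp at hnd
    have hG := (hD.2.1.2 a b c).2 ⟨hab, hcb, hne, fun h => hac ((hD.adj_iff _ _).2 h)⟩
    exact (List.pairwise_cons.1 hpc.tail).1 c (by simp) hG.2.1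

/-- A possibly causal path `x - y, …` as in the hypothesis of the theorem. -/
structure IsWitness (G : PDGraph V) (X Y Z : Finset V) (x y : V) (l : List V) : Prop where
  undir : G.Undir x y
  chain : (y :: l).IsChain G.Adj
  pairwise : (x :: y :: l).Pairwise fun a b => ¬ G.Dir b a
  nodup : (x :: y :: l).Nodup
  mem : x ∈ X
  proper : ∀ w ∈ y :: l, w ∉ X
  last : (y :: l).getLast (by simp) ∈ Y
  avoids : ∀ w ∈ y :: l, w ∉ Z

theorem exists_isWitness {X Y Z : Finset V} {p : List V} (hp : G.IsPossiblyCausalPath p)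
    (hXY : PDGraph.IsProperFromTo X Y p) (hu : G.StartsUndirected p) (hZ : ∀ w ∈ p, w ∉ Z) :
    ∃ x y l, G.IsWitness X Y Z x y l := by
  obtain ⟨x, y, l, rfl, hxy⟩ := hu
  obtain ⟨⟨-, hnd, hch⟩, hpw⟩ := hp
  obtain ⟨x', l', e, h, hx, hpr, hlast, he⟩ := hXY
  obtain ⟨rfl, rfl⟩ := List.cons_eq_cons.1 h
  refine ⟨x, y, l, hxy, hch.tail, hpw, hnd, hx, hpr, ?_, fun w hw => hZ w (by simp_all)⟩
  rw [List.getLast?_eq_getLast_of_ne_nil (by simp), Option.some.injEq,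
    List.getLast_cons (by simp)] at hlast
  exact hlast ▸ he

theorem IsWitness.sublist {X Y Z : Finset V} {x y y' : V} {l l' : List V}
    (h : G.IsWitness X Y Z x y l) (hs : (y' :: l').Sublist (y :: l)) (hu : G.Undir x y')
    (hc : (y' :: l').IsChain G.Adj) (hl : (y' :: l').getLast (by simp) ∈ Y) :
    G.IsWitness X Y Z x y' l' where
  undir := hu
  chain := hc
  pairwise := h.pairwise.sublist (hs.cons_cons x)
  nodup := h.nodup.sublist (hs.cons_cons x)
  mem := h.mem
  proper w hw := h.proper w (hs.subset hw)
  last := hl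
  avoids w hw := h.avoids w (hs.subset hw)

/-- A shortest witness works: otherwise one could stop at an earlier node of `Y`, take a shortcut
along a chord, or skip `y`. -/
theorem exists_isWitness_minimal {X Y Z : Finset V} (h : ∃ x y l, G.IsWitness X Y Z x y l) :
    ∃ x y l, G.IsWitness X Y Z x y l ∧ (∀ w ∈ (y :: l).dropLast, w ∉ Y) ∧
      (∀ u v w, [u, v, w] <:+: y :: l → ¬ G.Adj u w) ∧
      ∀ z l', l = z :: l' → ¬ G.Undir x z := by
  have hex : ∃ n, ∃ x y l, G.IsWitness X Y Z x y l ∧ l.length = n := by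
    obtain ⟨x, y, l, h⟩ := h
    exact ⟨_, x, y, l, h, rfl⟩
  classical
  obtain ⟨x, y, l, hw, hn⟩ := Nat.find_spec hex
  have hmin : ∀ y' l', G.IsWitness X Y Z x y' l' → ¬ l'.length < l.length := fun y' l' h' hlt =>
    Nat.find_min hex (hn ▸ hlt) ⟨x, y', l', h', rfl⟩
  refine ⟨x, y, l, hw, ?_, ?_, ?_⟩
  · intro w hwl hwY
    obtain ⟨s, t, hst⟩ := List.append_of_mem hwl
    have hyl : y :: l = (s ++ [w]) ++ (t ++ [(y :: l).getLast (by simp)]) := by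
      conv_lhs => rw [← List.dropLast_append_getLast (l := y :: l) (by simp), hst]
      simp
    cases s with
    | nil =>
      obtain ⟨rfl, hl⟩ : y = w ∧ l = t ++ [(y :: l).getLast (by simp)] := by simpa using hyl
      refine hmin y [] (hw.sublist (by simp) hw.undir (by simp) (by simpa using hwY)) ?_
      rw [hl]; simp
    | cons y' s =>
      obtain ⟨rfl, hl⟩ : y = y' ∧ l = (s ++ [w]) ++ (t ++ [(y :: l).getLast (by simp)]) := by
        simpa using hyl
      have hpre : (y :: (s ++ [w])) <+: y :: l := ⟨t ++ [(y :: l).getLast (by simp)], hyl.symm⟩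
      refine hmin y (s ++ [w]) (hw.sublist hpre.sublist hw.undir (hw.chain.prefix hpre) ?_) ?_
      · simpa [List.getLast_cons] using hwY
      · rw [hl]; simp
  · rintro u v w ⟨s, t, hst⟩ huw
    have hsub : (s ++ [u, w] ++ t).Sublist (y :: l) := by
      rw [← hst]
      exact ((List.Sublist.refl s).append (by simp)).append (List.Sublist.refl t)
    have hc := hw.chain
    rw [← hst] at hc
    have hc' : (s ++ [u, w] ++ t).IsChain G.Adj := by
      simp only [List.append_assoc, List.cons_append, List.nil_append] at hc ⊢
      rw [List.isChain_split] at hc ⊢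
      simp only [List.isChain_cons_cons] at hc ⊢
      exact ⟨hc.1, huw, hc.2.2.2⟩
    have hl : (s ++ [u, w] ++ t).getLast (by simp) ∈ Y := by
      have := hw.last
      simp only [← hst] at this
      convert this using 1
      simp
    have hlen := congrArg List.length hst
    cases s with
    | nil =>
      obtain ⟨rfl, -⟩ : u = y ∧ _ := by simpa using hst
      refine hmin u (w :: t) (hw.sublist hsub hw.undir hc' hl) ?_
      simp at hlen ⊢; omega
    | cons y' s =>
      obtain ⟨rfl, -⟩ : y' = y ∧ _ := by simpa using hst
      refine hmin y' (s ++ [u, w] ++ t) (hw.sublist hsub hw.undir hc' hl) ?_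
      simp at hlen ⊢; omega
  · rintro z l' rfl hu
    refine hmin z l' (hw.sublist (List.sublist_cons_self _ _) hu hw.chain.tail ?_) (by simp)
    have := hw.last
    rwa [List.getLast_cons (by simp)] at this

/-- Two represented DAGs which disagree on the first edge of the path and agree on the rest. -/
theorem exists_represents_pair [Fintype V] (hG : G.IsMPDAG) {X Y Z : Finset V} {x y : V}
    {l : List V} (hw : G.IsWitness X Y Z x y l)
    (hun : ∀ u v w, [u, v, w] <:+: y :: l → ¬ G.Adj u w)
    (hmin : ∀ z l', l = z :: l' → ¬ G.Undir x z) :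
    ∃ D₁ D₂, G.Represents D₁ ∧ G.Represents D₂ ∧ (x :: y :: l).IsChain D₁.Dir ∧
      (y :: l).IsChain D₂.Dir ∧ D₂.Dir y x := by
  classical
  obtain ⟨D, hD⟩ := hG.exists_represents
  have hcl := hG.meekClosed
  have hxy := hw.undir
  have pair : ∃ D₁, G.Represents D₁ ∧ D₁.Dir x y := by
    obtain ⟨D₁, hD₁, h⟩ := hcl.exists_represents_source hD x
    exact ⟨D₁, hD₁, h y hxy⟩
  -- Orienting all undirected edges away from `y` gives both `y → x` and a forward second edge.
  obtain ⟨D₂, hD₂, hsrc⟩ := hcl.exists_represents_source hD y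
  cases l with
  | nil =>
    obtain ⟨D₁, hD₁, h₁⟩ := pair
    exact ⟨D₁, D₂, hD₁, hD₂, by simpa using h₁, by simp, hsrc x (G.undir_symm _ _ hxy)⟩
  | cons z l =>
    have hyz : G.Adj y z := (List.isChain_cons_cons.1 hw.chain).1
    have hzy : ¬ G.Dir z y := (List.pairwise_cons.1 hw.pairwise.tail).1 z (by simp)
    have hzx : ¬ G.Dir z x := (List.pairwise_cons.1 hw.pairwise).1 z (by simp)
    have hxz : x ≠ z := by
      rintro rfl
      exact absurd hw.nodup (by simp)
    have hyz' : G.Dir y z ∨ G.Undir y z := hyz.imp_right fun h => h.resolve_left hzy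
    have rest : ∀ {D'}, G.Represents D' → D'.Dir y z → (y :: z :: l).IsChain D'.Dir :=
      fun hD' h => hD'.isChain_dir h hw.chain hw.pairwise.tail hun hw.nodup.tail
    have first : ∃ D₁, G.Represents D₁ ∧ D₁.Dir x y ∧ D₁.Dir y z := by
      rcases hyz' with hyz' | hyz'
      · obtain ⟨D₁, hD₁, h₁⟩ := pair
        exact ⟨D₁, hD₁, h₁, hD₁.2.2 _ _ hyz'⟩
      -- If `x` and `z` are adjacent, minimality and possible causality force `x → z`, so the
      -- triangle can be ordered `x, y, z`. If not, `x → y` already forces `y → z`, since a collider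
      -- at `y` would appear in `G`.
      by_cases hadj : G.Adj x z
      · have hxzd : G.Dir x z := by
          rcases hadj with h | h | h
          · exact h
          · exact absurd h hzx
          · exact absurd h (hmin z l rfl)
        have hne : x ≠ y := (adj_of_undir hxy).ne
        have hne' : y ≠ z := hyz.ne
        obtain ⟨D₁, hD₁, h⟩ := hcl.exists_represents_of_clique hD y {x, y, z}
          (by
            simp only [Finset.mem_insert, Finset.mem_singleton]
            rintro k (rfl | rfl | rfl)
            · exact undirConnected_of_undir (G.undir_symm _ _ hxy)
            · exact .refl
            · exact undirConnected_of_undir hyz')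
          (by
            simp only [Finset.mem_insert, Finset.mem_singleton]
            have h₁ := adj_of_undir hxy
            rintro a (rfl | rfl | rfl) b (rfl | rfl | rfl) hab <;>
              first
              | exact absurd rfl hab
              | assumption
              | (apply Adj.symm; assumption))
          (fun a => if a = x then 0 else if a = y then 1 else 2)
          (by
            have irr : ∀ a, ¬ G.Dir a a := fun a h => (adj_of_dir h).ne rfl
            have h₁ := not_dir_of_undir' hxy
            simp only [Finset.mem_insert, Finset.mem_singleton]
            rintro a (rfl | rfl | rfl) b (rfl | rfl | rfl) hab <;>
              first
              | exact irr _
              | assumption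
              | simp [hne.symm, hne'.symm, hxz.symm] at hab)
        exact ⟨D₁, hD₁, h x (by simp) y (by simp) (by simp [hne.symm]),
          h y (by simp) z (by simp) (by simp [hne.symm, hne'.symm, hxz.symm])⟩
      · obtain ⟨D₁, hD₁, h₁⟩ := pair
        refine ⟨D₁, hD₁, h₁, (hD₁.dir_or_dir hyz).resolve_right fun h => ?_⟩
        exact hzy ((hD₁.2.1.2 x y z).2 ⟨h₁, h, hxz, fun h => hadj ((hD₁.adj_iff _ _).2 h)⟩).2.1
    obtain ⟨D₁, hD₁, h₁, h₁'⟩ := first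
    exact ⟨D₁, D₂, hD₁, hD₂, List.isChain_cons_cons.2 ⟨h₁, rest hD₁ h₁'⟩,
      rest hD₂ (hyz'.elim (hD₂.2.2 _ _) (hsrc z)), hsrc x (G.undir_symm _ _ hxy)⟩

end Paths

end PDGraph

/-! ### Recursive models and the truncated factorization -/

section Markov

variable {V : Type*} [DecidableEq V]

theorem DependsOn.update_eq {h : (V → ℝ) → ℝ≥0∞} {s : Set V} (hh : DependsOn h s) {i : V}
    (hi : i ∉ s) (v : V → ℝ) (t : ℝ) : h (Function.update v i t) = h v :=
  hh fun _ hj => Function.update_of_ne (ne_of_mem_of_not_mem hj hi) _ _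

theorem lmarginal_mul_left {h f : (V → ℝ) → ℝ≥0∞} {T : Finset V} {s : Set V}
    (hh : DependsOn h s) (hs : ∀ i ∈ T, i ∉ s) (hf : Measurable f) (v : V → ℝ) :
    lmarginal (fun _ => volume) T (fun v => h v * f v) v =
      h v * lmarginal (fun _ => volume) T f v := by
  unfold lmarginal
  have hm : Measurable fun y => f (Function.updateFinset v T y) := hf.comp measurable_updateFinset
  rw [← lintegral_const_mul _ hm]
  refine lintegral_congr fun y => ?_
  refine congrArg (· * _) (hh fun i hi => ?_)
  rw [Function.updateFinset, dif_neg fun h => hs i h hi]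

/-- Transition densities of a recursive model in which `P i` are the parents of `i`. -/
structure IsRecursiveModel (P : V → Finset V) (q : V → (V → ℝ) → ℝ≥0∞) : Prop where
  measurable : ∀ i, Measurable (q i)
  dependsOn : ∀ i, DependsOn (q i) (insert i (P i) : Finset V)
  lintegral_eq_one : ∀ i v, ∫⁻ t : ℝ, q i (Function.update v i t) = 1

theorem IsRecursiveModel.measurable_prod {P : V → Finset V} {q : V → (V → ℝ) → ℝ≥0∞}
    (hq : IsRecursiveModel P q) (S : Finset V) : Measurable fun v => ∏ i ∈ S, q i v :=
  Finset.measurable_fun_prod _ fun i _ => hq.measurable i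

/-- Integrating out a set of variables which is closed under children. -/
theorem IsRecursiveModel.lmarginal_prod {P : V → Finset V} {q : V → (V → ℝ) → ℝ≥0∞}
    (hq : IsRecursiveModel P q) {r : V → ℕ} (hr : ∀ i, ∀ j ∈ P i, r j < r i)
    (T S : Finset V) (hTS : T ⊆ S) (hT : ∀ j ∈ S, j ∉ T → ∀ i ∈ T, i ∉ P j) :
    lmarginal (fun _ => volume) T (fun v => ∏ i ∈ S, q i v) = fun v => ∏ i ∈ S \ T, q i v := by
  induction T using Finset.strongInduction generalizing S with
  | H T ih =>
  rcases T.eq_empty_or_nonempty with rfl | hne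
  · simp
  -- The highest node of `T` is a parent of no other node of `S`, so integrating it out removes
  -- exactly its own factor.
  obtain ⟨i, hi, hmax⟩ := T.exists_max_image r hne
  have hiS := hTS hi
  have hiP : ∀ j ∈ S, j ≠ i → i ∉ (insert j (P j) : Finset V) := by
    intro j hj hji h
    rcases Finset.mem_insert.1 h with h | h
    · exact hji h.symm
    · by_cases hjT : j ∈ T
      · exact (hr j i h).not_ge (hmax j hjT)
      · exact hT j hj hjT i hi h
  rw [lmarginal_erase' _ (hq.measurable_prod S) hi]
  have hint : (fun v => ∫⁻ t : ℝ, ∏ j ∈ S, q j (Function.update v i t)) =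
      fun v => ∏ j ∈ S.erase i, q j v := by
    funext v
    have : ∀ t : ℝ, ∏ j ∈ S, q j (Function.update v i t) =
        q i (Function.update v i t) * ∏ j ∈ S.erase i, q j v := by
      intro t
      rw [← Finset.mul_prod_erase S _ hiS]
      congr 1
      refine Finset.prod_congr rfl fun j hj => (hq.dependsOn j).update_eq ?_ v t
      exact fun h => hiP j (Finset.mem_of_mem_erase hj) (Finset.ne_of_mem_erase hj) h
    have hm : Measurable fun t => q i (Function.update v i t) :=
      (hq.measurable i).comp (measurable_update v)
    simp_rw [this]
    rw [lintegral_mul_const _ hm,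
      hq.lintegral_eq_one, one_mul]
  rw [hint, ih (T.erase i) (Finset.erase_ssubset hi) (S.erase i) (Finset.erase_subset_erase i hTS)]
  · have : S.erase i \ T.erase i = S \ T := by
      ext j
      simp only [Finset.mem_sdiff, Finset.mem_erase]
      by_cases hj : j = i
      · subst hj; simp [hi]
      · simp [hj]
    rw [this]
  · intro j hj hjT k hk
    obtain ⟨hji, hjS⟩ := Finset.mem_erase.1 hj
    exact hT j hjS (fun h => hjT (Finset.mem_erase.2 ⟨hji, h⟩)) k (Finset.mem_of_mem_erase hk)

variable [Fintype V]

theorem IsRecursiveModel.marginalDensity_prod {P : V → Finset V} {q : V → (V → ℝ) → ℝ≥0∞}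
    (hq : IsRecursiveModel P q) {r : V → ℕ} (hr : ∀ i, ∀ j ∈ P i, r j < r i)
    (A : Finset V) (hA : ∀ j ∈ A, P j ⊆ A) :
    marginalDensity (fun v => ∏ i, q i v) A = fun v => ∏ i ∈ A, q i v := by
  unfold marginalDensity
  rw [hq.lmarginal_prod hr Aᶜ Finset.univ (Finset.subset_univ _)]
  · simp
  · intro j _ hj i hi hij
    rw [Finset.mem_compl, not_not] at hj
    exact Finset.mem_compl.1 hi (hA j hj hij)

theorem IsRecursiveModel.isCondDensity {P : V → Finset V} {q : V → (V → ℝ) → ℝ≥0∞}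
    (hq : IsRecursiveModel P q) {r : V → ℕ} (hr : ∀ i, ∀ j ∈ P i, r j < r i) (i : V) :
    IsCondDensity (fun v => ∏ i, q i v) i (P i) (q i) := by
  refine ⟨hq.measurable i, hq.dependsOn i, hq.lintegral_eq_one i, Filter.Eventually.of_forall ?_⟩
  -- Both `A` and `insert i A` contain the parents of their members, so their marginals are products
  -- that differ by the factor `q i`. That factor does not involve `A \ P i`, so it comes out when
  -- those nodes are integrated.
  set A : Finset V := Finset.univ.filter fun j => r j < r i with hA
  have memA : ∀ j, j ∈ A ↔ r j < r i := fun j => by simp [hA]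
  have hPA : P i ⊆ A := fun j hj => (memA j).2 (hr i j hj)
  have hiA : i ∉ A := fun h => ((memA i).1 h).false
  have hclA : ∀ j ∈ A, P j ⊆ A := fun j hj k hk =>
    (memA k).2 ((hr j k hk).trans ((memA j).1 hj))
  have hclA' : ∀ j ∈ insert i A, P j ⊆ insert i A := by
    intro j hj
    refine Finset.Subset.trans ?_ (Finset.subset_insert i A)
    rcases Finset.mem_insert.1 hj with rfl | hj
    · exact hPA
    · exact hclA j hj
  have hm := hq.measurable_prod Finset.univ
  have h₁ : (insert i (P i))ᶜ = (insert i A)ᶜ ∪ (A \ P i) := by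
    ext j
    have := @hPA j
    by_cases hj : j = i
    · subst hj; simp [hiA]
    · simp only [Finset.mem_compl, Finset.mem_insert, Finset.mem_union, Finset.mem_sdiff, hj]
      tauto
  have h₂ : (P i)ᶜ = Aᶜ ∪ (A \ P i) := by
    ext j
    have := @hPA j
    simp only [Finset.mem_compl, Finset.mem_union, Finset.mem_sdiff]
    tauto
  have e₁ := hq.marginalDensity_prod hr (insert i A) hclA'
  have e₂ := hq.marginalDensity_prod hr A hclA
  unfold marginalDensity at e₁ e₂ ⊢
  intro v
  rw [h₁, h₂, lmarginal_union' _ _ hm, lmarginal_union' _ _ hm, e₁, e₂]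
  · simp_rw [Finset.prod_insert hiA]
    refine lmarginal_mul_left (hq.dependsOn i) ?_ (hq.measurable_prod A) v
    intro j hj h
    obtain ⟨hjA, hjP⟩ := Finset.mem_sdiff.1 hj
    rcases Finset.mem_insert.1 h with rfl | h
    · exact hiA hjA
    · exact hjP h
  · exact Finset.disjoint_of_subset_right Finset.sdiff_subset disjoint_compl_left
  · exact Finset.disjoint_of_subset_right (Finset.sdiff_subset.trans (Finset.subset_insert i A))
      disjoint_compl_left

open scoped Classical in
/-- The interventional densities given by the truncated factorization. -/
noncomputable def truncatedFactorization (q : V → (V → ℝ) → ℝ≥0∞) : InterventionalFamily V :=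
  fun A a v => if ∀ i : A, v i = a i then ∏ i ∈ Aᶜ, q i v else 0

theorem truncatedFactorization_obs (q : V → (V → ℝ) → ℝ≥0∞) :
    (truncatedFactorization q).obs = fun v => ∏ i, q i v := by
  funext v
  simp [InterventionalFamily.obs, truncatedFactorization]

theorem IsRecursiveModel.compatible {D : PDGraph V} (hD : D.IsDAG) {q : V → (V → ℝ) → ℝ≥0∞}
    (hq : IsRecursiveModel D.parents q) (hpos : ∀ i v, 0 < q i v) (hlt : ∀ i v, q i v < ∞) :
    D.Compatible (truncatedFactorization q) := by
  obtain ⟨r, hr⟩ := hD.2.exists_rank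
  have hr' : ∀ i, ∀ j ∈ D.parents i, r j < r i := fun i j hj =>
    hr j i (by simpa [PDGraph.parents] using hj)
  unfold PDGraph.Compatible
  rw [truncatedFactorization_obs]
  refine ⟨⟨hq.measurable_prod _, fun v => ?_, fun v => ?_, ?_⟩, q, fun i => hq.isCondDensity hr' i,
    fun A a v => rfl⟩
  · exact pos_iff_ne_zero.2 (Finset.prod_ne_zero_iff.2 fun i _ => (hpos i v).ne')
  · exact ENNReal.prod_lt_top fun i _ => hlt i v
  · have h := hq.lmarginal_prod hr' Finset.univ Finset.univ subset_rfl (by simp)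
    rw [lmarginal_univ] at h
    simpa [← volume_pi] using congrFun h 0

theorem marginalDensity_truncatedFactorization (q : V → (V → ℝ) → ℝ≥0∞) {X A : Finset V}
    (hXA : X ⊆ A) (v : V → ℝ) :
    marginalDensity (truncatedFactorization q X fun i => v i) A v =
      lmarginal (fun _ => volume) Aᶜ (fun v => ∏ i ∈ Xᶜ, q i v) v := by
  unfold marginalDensity lmarginal
  refine lintegral_congr fun y => if_pos fun i => ?_
  rw [Function.updateFinset, dif_neg]
  simpa using hXA i.2

end Markov

/-! ### The sign-correlation kernel -/

section SignKernel

open ProbabilityTheory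

noncomputable def unitSign (t : ℝ) : ℝ := if t < 0 then -1 else 1

theorem unitSign_eq (t : ℝ) : unitSign t = -1 ∨ unitSign t = 1 := by
  unfold unitSign
  split_ifs <;> simp

theorem measurable_unitSign : Measurable unitSign :=
  Measurable.ite measurableSet_Iio measurable_const measurable_const

/-- The density, relative to the standard Gaussian, of a pair of Gaussian variables whose signs
have correlation `c`. -/
noncomputable def signKernel (c a b : ℝ) : ℝ≥0∞ := ENNReal.ofReal (1 + c * unitSign a * unitSign b)

theorem signKernel_comm (c a b : ℝ) : signKernel c a b = signKernel c b a := by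
  unfold signKernel
  ring_nf

theorem signKernel_zero (a b : ℝ) : signKernel 0 a b = 1 := by simp [signKernel]

theorem signKernel_pos {c : ℝ} (hc : 0 ≤ c) (hc1 : c < 1) (a b : ℝ) : 0 < signKernel c a b := by
  rw [signKernel, ENNReal.ofReal_pos]
  rcases unitSign_eq a with h | h <;> rcases unitSign_eq b with h' | h' <;> rw [h, h'] <;> linarith

theorem signKernel_lt_top (c a b : ℝ) : signKernel c a b < ∞ := ENNReal.ofReal_lt_top

theorem signKernel_ne_one {c : ℝ} (hc : 0 < c) (hc1 : c < 1) (a b : ℝ) : signKernel c a b ≠ 1 := by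
  rw [signKernel, ← ENNReal.ofReal_one, Ne, ENNReal.ofReal_eq_ofReal_iff _ zero_le_one]
  all_goals
    rcases unitSign_eq a with h | h <;> rcases unitSign_eq b with h' | h' <;> rw [h, h'] <;>
      linarith

theorem measurable_signKernel (c : ℝ) : Measurable fun p : ℝ × ℝ => signKernel c p.1 p.2 :=
  ENNReal.measurable_ofReal.comp (measurable_const.add
    ((measurable_const.mul (measurable_unitSign.comp measurable_fst)).mul
      (measurable_unitSign.comp measurable_snd)))

/-- The standard Gaussian density. -/
noncomputable abbrev stdGaussianPDF : ℝ → ℝ≥0∞ := gaussianPDF 0 1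

theorem setLIntegral_stdGaussianPDF_Iio :
    ∫⁻ t in Set.Iio 0, stdGaussianPDF t = 2⁻¹ ∧ ∫⁻ t in (Set.Iio 0)ᶜ, stdGaussianPDF t = 2⁻¹ := by
  have hsum : (∫⁻ t in Set.Iio 0, stdGaussianPDF t) + ∫⁻ t in (Set.Iio 0)ᶜ, stdGaussianPDF t = 1 := by
    rw [lintegral_add_compl _ measurableSet_Iio]
    exact lintegral_gaussianPDF_eq_one 0 one_ne_zero
  have heq : ∫⁻ t in (Set.Iio 0)ᶜ, stdGaussianPDF t = ∫⁻ t in Set.Iio 0, stdGaussianPDF t := by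
    rw [Set.compl_Iio, setLIntegral_congr Ioi_ae_eq_Ici.symm]
    have h := (Measure.measurePreserving_neg (volume : Measure ℝ)).setLIntegral_comp_preimage
      (measurableSet_Iio (a := (0 : ℝ))) (measurable_gaussianPDF 0 1)
    rw [← h]
    simp [gaussianPDF, gaussianPDFReal]
  rw [heq, ← two_mul] at hsum
  have h := ENNReal.eq_inv_of_mul_eq_one_left ((mul_comm _ _).trans hsum)
  exact ⟨h, heq.trans h⟩

theorem lintegral_stdGaussianPDF_mul_ite (A B : ℝ≥0∞) :
    ∫⁻ t, stdGaussianPDF t * (if t < 0 then A else B) = 2⁻¹ * (A + B) := by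
  rw [← lintegral_add_compl _ (measurableSet_Iio (a := (0 : ℝ))),
    setLIntegral_congr_fun measurableSet_Iio (g := fun t => stdGaussianPDF t * A),
    setLIntegral_congr_fun measurableSet_Iio.compl (g := fun t => stdGaussianPDF t * B),
    lintegral_mul_const _ (measurable_gaussianPDF 0 1),
    lintegral_mul_const _ (measurable_gaussianPDF 0 1), setLIntegral_stdGaussianPDF_Iio.1,
    setLIntegral_stdGaussianPDF_Iio.2, mul_add]
  · intro t ht
    have : ¬ t < 0 := ht
    simp [this]
  · intro t ht
    have : t < 0 := ht
    simp [this]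

/-- The integrand apart from the Gaussian depends only on the sign of `t`, and both signs have mass
`2⁻¹`. Averaging kills the terms linear in the sign and leaves the product of the correlations. -/
theorem lintegral_signKernel_mul {c d : ℝ} (hc : 0 ≤ c) (hc1 : c < 1) (hd : 0 ≤ d) (hd1 : d < 1)
    (a b : ℝ) :
    ∫⁻ t, stdGaussianPDF t * (signKernel c a t * signKernel d t b) = signKernel (c * d) a b := by
  have hite : ∀ t, signKernel c a t * signKernel d t b =
      if t < 0 then ENNReal.ofReal ((1 - c * unitSign a) * (1 - d * unitSign b))
      else ENNReal.ofReal ((1 + c * unitSign a) * (1 + d * unitSign b)) := by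
    intro t
    have ha : 0 ≤ 1 + c * unitSign a ∧ 0 ≤ 1 - c * unitSign a := by
      rcases unitSign_eq a with h | h <;> rw [h] <;> constructor <;> linarith
    split_ifs with h
    · have ht : unitSign t = -1 := if_pos h
      rw [ENNReal.ofReal_mul ha.2, signKernel, signKernel, ht]
      congr 2 <;> ring
    · have ht : unitSign t = 1 := if_neg h
      rw [ENNReal.ofReal_mul ha.1, signKernel, signKernel, ht]
      congr 2 <;> ring
  simp_rw [hite]
  rw [lintegral_stdGaussianPDF_mul_ite, ← ENNReal.ofReal_add, signKernel,
    show (2⁻¹ : ℝ≥0∞) = ENNReal.ofReal 2⁻¹ by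
      rw [ENNReal.ofReal_inv_of_pos two_pos]; simp, ← ENNReal.ofReal_mul (by norm_num)]
  · congr 1
    ring
  all_goals
    rcases unitSign_eq a with h | h <;> rcases unitSign_eq b with h' | h' <;> rw [h, h'] <;>
      apply mul_nonneg <;> linarith

theorem lintegral_signKernel {c : ℝ} (hc : 0 ≤ c) (hc1 : c < 1) (a : ℝ) :
    ∫⁻ t, stdGaussianPDF t * signKernel c a t = 1 := by
  -- With second correlation `0` that kernel is `1`, and the value of its endpoint is irrelevant.
  have h := lintegral_signKernel_mul hc hc1 le_rfl zero_lt_one a 0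
  simpa [signKernel_zero] using h

end SignKernel

/-! ### Gaussian variables coupled along a path -/

section Chain

variable {V : Type*}

/-- The product of the correlations along the path `a, l`, the first of which is `c`. -/
noncomputable def chainWeight : ℝ → V → List V → (V → ℝ) → ℝ≥0∞
  | _, _, [], _ => 1
  | c, a, b :: l, v => signKernel c (v a) (v b) * chainWeight 2⁻¹ b l v

theorem measurable_signKernel_apply (c : ℝ) (a b : V) :
    Measurable fun v : V → ℝ => signKernel c (v a) (v b) :=
  ENNReal.measurable_ofReal.comp (measurable_const.add
    ((measurable_const.mul (measurable_unitSign.comp (measurable_pi_apply a))).mul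
      (measurable_unitSign.comp (measurable_pi_apply b))))

theorem measurable_chainWeight (c : ℝ) (a : V) (l : List V) : Measurable (chainWeight c a l) := by
  induction l generalizing c a with
  | nil => exact measurable_const
  | cons b l ih => exact (measurable_signKernel_apply c a b).mul (ih _ _)

theorem chainWeight_update [DecidableEq V] {i a : V} {l : List V} (hi : i ∉ a :: l) (c : ℝ) (v : V → ℝ) (t : ℝ) :
    chainWeight c a l (Function.update v i t) = chainWeight c a l v := by
  induction l generalizing c a with
  | nil => rfl
  | cons b l ih =>
    rw [List.mem_cons, not_or] at hi
    have hb : b ≠ i := fun h => hi.2 (h ▸ List.mem_cons_self)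
    simp only [chainWeight]
    rw [ih hi.2, Function.update_of_ne (Ne.symm hi.1), Function.update_of_ne hb]

theorem measurable_prod_stdGaussianPDF_mul {g : (V → ℝ) → ℝ≥0∞} (hg : Measurable g)
    (S : Finset V) : Measurable fun v : V → ℝ => (∏ i ∈ S, stdGaussianPDF (v i)) * g v :=
  (Finset.measurable_fun_prod _ fun i _ =>
    (ProbabilityTheory.measurable_gaussianPDF 0 1).comp (measurable_pi_apply i)).mul hg

variable [DecidableEq V]

theorem lmarginal_stdGaussianPDF_erase {g : (V → ℝ) → ℝ≥0∞} (hg : Measurable g) {S T : Finset V}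
    {b : V} (hb : b ∈ T) (hTS : T ⊆ S) :
    lmarginal (fun _ => volume) T (fun v => (∏ i ∈ S, stdGaussianPDF (v i)) * g v) =
      lmarginal (fun _ => volume) (T.erase b) (fun v => (∏ i ∈ S.erase b, stdGaussianPDF (v i)) *
        ∫⁻ t, stdGaussianPDF t * g (Function.update v b t)) := by
  rw [lmarginal_erase' _ (measurable_prod_stdGaussianPDF_mul hg S) hb]
  congr 1
  funext v
  have hm : Measurable fun t : ℝ => stdGaussianPDF t * g (Function.update v b t) :=
    (ProbabilityTheory.measurable_gaussianPDF 0 1).mul (hg.comp (measurable_update v))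
  rw [← lintegral_const_mul _ hm]
  refine lintegral_congr fun t => ?_
  rw [← Finset.mul_prod_erase S _ (hTS hb), Function.update_self, Finset.prod_congr rfl
    fun i hi => by rw [Function.update_of_ne (Finset.ne_of_mem_erase hi)]]
  ring

theorem erase_sdiff_erase_of_mem {S T : Finset V} {b : V} (hb : b ∈ T) :
    S.erase b \ T.erase b = S \ T := by
  ext j
  simp only [Finset.mem_sdiff, Finset.mem_erase]
  by_cases hj : j = b
  · subst hj; simp [hb]
  · simp [hj]

theorem lmarginal_stdGaussianPDF {g : (V → ℝ) → ℝ≥0∞} (hg : Measurable g) {S T : Finset V}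
    (hTS : T ⊆ S) (hgT : ∀ i ∈ T, ∀ v t, g (Function.update v i t) = g v) :
    lmarginal (fun _ => volume) T (fun v => (∏ i ∈ S, stdGaussianPDF (v i)) * g v) =
      fun v => (∏ i ∈ S \ T, stdGaussianPDF (v i)) * g v := by
  induction T using Finset.strongInduction generalizing S with
  | H T ih =>
  rcases T.eq_empty_or_nonempty with rfl | ⟨b, hb⟩
  · simp
  rw [lmarginal_stdGaussianPDF_erase hg hb hTS]
  simp_rw [hgT b hb]
  simp_rw [lintegral_mul_const _ (ProbabilityTheory.measurable_gaussianPDF 0 1),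
    ProbabilityTheory.lintegral_gaussianPDF_eq_one 0 one_ne_zero, one_mul]
  rw [ih _ (Finset.erase_ssubset hb) (Finset.erase_subset_erase b hTS)
    fun i hi => hgT i (Finset.mem_of_mem_erase hi), erase_sdiff_erase_of_mem hb]

theorem lintegral_chainWeight_cons_cons {c : ℝ} (hc : 0 ≤ c) (hc1 : c < 1) {a b d : V} {l : List V}
    (hn : (a :: b :: d :: l).Nodup) (v : V → ℝ) :
    ∫⁻ t, stdGaussianPDF t * chainWeight c a (b :: d :: l) (Function.update v b t) =
      chainWeight (c * 2⁻¹) a (d :: l) v := by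
  simp only [List.nodup_cons, List.mem_cons, not_or] at hn
  have hb : b ∉ d :: l := by simp [hn.2.1]
  simp only [chainWeight]
  simp_rw [chainWeight_update hb, Function.update_self, Function.update_of_ne hn.1.1,
    Function.update_of_ne (Ne.symm hn.2.1.1), ← mul_assoc]
  have hm : Measurable fun t => stdGaussianPDF t * signKernel c (v a) t *
      signKernel 2⁻¹ t (v d) :=
    ((ProbabilityTheory.measurable_gaussianPDF 0 1).mul
      ((measurable_signKernel c).comp (measurable_const.prodMk measurable_id))).mul
      ((measurable_signKernel 2⁻¹).comp (measurable_id.prodMk measurable_const))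
  rw [lintegral_mul_const _ hm]
  simp_rw [mul_assoc]
  rw [lintegral_signKernel_mul hc hc1 (by norm_num) (by norm_num)]

theorem lintegral_chainWeight_singleton {c : ℝ} (hc : 0 ≤ c) (hc1 : c < 1) {a b : V} (hab : a ≠ b)
    (v : V → ℝ) : ∫⁻ t, stdGaussianPDF t * chainWeight c a [b] (Function.update v b t) = 1 := by
  simp only [chainWeight, mul_one]
  simp_rw [Function.update_self, Function.update_of_ne hab]
  exact lintegral_signKernel hc hc1 _

/-- Integrating out the inner nodes of the path. -/
theorem lmarginal_chainWeight_dropLast {c : ℝ} (hc : 0 ≤ c) (hc1 : c < 1) {a b : V} {l : List V}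
    (hn : (a :: b :: l).Nodup) {S T : Finset V} (hTS : T ⊆ S) (ha : a ∉ T)
    (hl : ∀ w ∈ (b :: l).dropLast, w ∈ T) (hlast : (b :: l).getLast (by simp) ∉ T) :
    lmarginal (fun _ => volume) T
        (fun v => (∏ i ∈ S, stdGaussianPDF (v i)) * chainWeight c a (b :: l) v) =
      fun v => (∏ i ∈ S \ T, stdGaussianPDF (v i)) *
        signKernel (c * 2⁻¹ ^ l.length) (v a) (v ((b :: l).getLast (by simp))) := by
  induction l generalizing c b S T with
  | nil =>
    rw [lmarginal_stdGaussianPDF (measurable_chainWeight _ _ _) hTS]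
    · simp [chainWeight]
    · intro i hi v t
      have hia : i ≠ a := fun h => ha (h ▸ hi)
      have hib : i ≠ b := fun h => hlast (by simpa using h ▸ hi)
      exact chainWeight_update (by simp [hia, hib]) _ _ _
  | cons d l ih =>
    have hb : b ∈ T := hl b (by simp)
    have hsub : (a :: d :: l).Sublist (a :: b :: d :: l) := by simp
    have hbn : b ∉ d :: l := (List.nodup_cons.1 hn.tail).1
    rw [lmarginal_stdGaussianPDF_erase (measurable_chainWeight _ _ _) hb hTS]
    -- Integrating out `b` merges its two kernels and halves the leading correlation, which is why
    -- the induction is over arbitrary `c`.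
    simp_rw [lintegral_chainWeight_cons_cons hc hc1 hn]
    rw [ih (by positivity) (by linarith) (hn.sublist hsub) (Finset.erase_subset_erase b hTS)
      (fun h => ha (Finset.mem_of_mem_erase h)), erase_sdiff_erase_of_mem hb]
    · simp [pow_succ', mul_assoc]
    · intro w hw
      refine Finset.mem_erase.2 ⟨?_, hl w (by simp_all)⟩
      rintro rfl
      exact hbn (List.mem_of_mem_dropLast hw)
    · intro h
      exact hlast (by simpa using Finset.mem_of_mem_erase h)

/-- Integrating out the whole path except its first node. -/
theorem lmarginal_chainWeight {c : ℝ} (hc : 0 ≤ c) (hc1 : c < 1) {a b : V} {l : List V}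
    (hn : (a :: b :: l).Nodup) {S T : Finset V} (hTS : T ⊆ S) (hl : ∀ w ∈ b :: l, w ∈ T) :
    lmarginal (fun _ => volume) T
        (fun v => (∏ i ∈ S, stdGaussianPDF (v i)) * chainWeight c a (b :: l) v) =
      fun v => ∏ i ∈ S \ T, stdGaussianPDF (v i) := by
  induction l generalizing c b S T with
  | nil =>
    have hb : b ∈ T := hl b (by simp)
    rw [lmarginal_stdGaussianPDF_erase (measurable_chainWeight _ _ _) hb hTS]
    simp_rw [lintegral_chainWeight_singleton hc hc1 (show a ≠ b by rintro rfl; simp at hn)]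
    rw [lmarginal_stdGaussianPDF (g := fun _ => 1) measurable_const
      (Finset.erase_subset_erase b hTS) (fun _ _ _ _ => rfl), erase_sdiff_erase_of_mem hb]
    simp
  | cons d l ih =>
    have hb : b ∈ T := hl b (by simp)
    have hsub : (a :: d :: l).Sublist (a :: b :: d :: l) := by simp
    have hbn : b ∉ d :: l := (List.nodup_cons.1 hn.tail).1
    rw [lmarginal_stdGaussianPDF_erase (measurable_chainWeight _ _ _) hb hTS]
    simp_rw [lintegral_chainWeight_cons_cons hc hc1 hn]
    rw [ih (by positivity) (by linarith) (hn.sublist hsub) (Finset.erase_subset_erase b hTS),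
      erase_sdiff_erase_of_mem hb]
    intro w hw
    refine Finset.mem_erase.2 ⟨?_, hl w (List.mem_cons_of_mem _ hw)⟩
    rintro rfl
    exact hbn hw

/-- The factor contributed to the conditional density of `i` by its predecessor in the path. -/
noncomputable def pathFactor : List V → V → (V → ℝ) → ℝ≥0∞
  | a :: b :: l, i, v => (if i = b then signKernel 2⁻¹ (v a) (v b) else 1) * pathFactor (b :: l) i v
  | _, _, _ => 1

theorem prod_pathFactor {a : V} {l : List V} {S : Finset V} (hl : ∀ w ∈ l, w ∈ S) (v : V → ℝ) :
    ∏ i ∈ S, pathFactor (a :: l) i v = chainWeight 2⁻¹ a l v := by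
  induction l generalizing a with
  | nil => simp [pathFactor, chainWeight]
  | cons b l ih =>
    simp only [pathFactor, chainWeight]
    rw [Finset.prod_mul_distrib, ih fun w hw => hl w (List.mem_cons_of_mem _ hw),
      Finset.prod_ite_eq', if_pos (hl b (by simp))]

theorem pathFactor_of_notMem {a i : V} {l : List V} (hi : i ∉ l) (v : V → ℝ) :
    pathFactor (a :: l) i v = 1 := by
  induction l generalizing a with
  | nil => rfl
  | cons b l ih =>
    rw [List.mem_cons, not_or] at hi
    rw [pathFactor, if_neg hi.1, ih hi.2, one_mul]

/-- Every factor is trivial or couples the node with one parent. -/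
def IsParentCoupling (D : PDGraph V) (g : V → (V → ℝ) → ℝ≥0∞) : Prop :=
  ∀ i, (∀ v, g i v = 1) ∨ ∃ j, D.Dir j i ∧ ∀ v, g i v = signKernel 2⁻¹ (v j) (v i)

theorem isParentCoupling_pathFactor {D : PDGraph V} {p : List V} (hn : p.Nodup)
    (hp : p.IsChain D.Dir) : IsParentCoupling D (pathFactor p) := by
  intro i
  induction p with
  | nil => exact Or.inl fun v => rfl
  | cons a l ih =>
    cases l with
    | nil => exact Or.inl fun v => rfl
    | cons b l =>
      by_cases hi : i = b
      · subst hi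
        refine Or.inr ⟨a, (List.isChain_cons_cons.1 hp).1, fun v => ?_⟩
        rw [pathFactor, if_pos rfl, pathFactor_of_notMem (List.nodup_cons.1 hn.tail).1, mul_one]
      · have h : ∀ v, pathFactor (a :: b :: l) i v = pathFactor (b :: l) i v := fun v => by
          rw [pathFactor, if_neg hi, one_mul]
        simpa only [h] using ih hn.tail hp.tail

/-- A Gaussian times a sign kernel is a positive transition density that uses only one of the
parents; ignoring the other parents is harmless. -/
theorem IsParentCoupling.compatible [Fintype V] {D : PDGraph V} (hD : D.IsDAG)
    {g : V → (V → ℝ) → ℝ≥0∞} (hg : IsParentCoupling D g) :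
    D.Compatible (truncatedFactorization fun i v => stdGaussianPDF (v i) * g i v) := by
  have hγ : ∀ t, 0 < stdGaussianPDF t := ProbabilityTheory.gaussianPDF_pos 0 one_ne_zero
  have hγm := ProbabilityTheory.measurable_gaussianPDF 0 1
  have hpos : ∀ i v, 0 < g i v := fun i v => by
    rcases hg i with h | ⟨j, -, h⟩
    · simp [h]
    · rw [h]; exact signKernel_pos (by norm_num) (by norm_num) _ _
  have hlt : ∀ i v, g i v < ∞ := fun i v => by
    rcases hg i with h | ⟨j, -, h⟩
    · simp [h]
    · rw [h]; exact signKernel_lt_top _ _ _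
  refine IsRecursiveModel.compatible hD ⟨fun i => ?_, fun i => ?_, fun i v => ?_⟩
    (fun i v => ENNReal.mul_pos (hγ _).ne' (hpos i v).ne')
    (fun i v => ENNReal.mul_lt_top ProbabilityTheory.gaussianPDF_lt_top (hlt i v))
  · refine (hγm.comp (measurable_pi_apply i)).mul ?_
    rcases hg i with h | ⟨j, -, h⟩
    · rw [funext h]; exact measurable_const
    · rw [funext h]; exact measurable_signKernel_apply _ _ _
  · intro v w hvw
    have hi : v i = w i := hvw i (by simp)
    simp only [hi]
    rcases hg i with h | ⟨j, hj, h⟩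
    · rw [h, h]
    · rw [h, h, hi, hvw j (by simp [PDGraph.parents, hj])]
  · simp only [Function.update_self]
    rcases hg i with h | ⟨j, hj, h⟩
    · simp_rw [h, mul_one]
      exact ProbabilityTheory.lintegral_gaussianPDF_eq_one 0 one_ne_zero
    · simp_rw [h, Function.update_self, Function.update_of_ne (PDGraph.adj_of_dir hj).ne]
      exact lintegral_signKernel (by norm_num) (by norm_num) _

end Chain

theorem propositionC1 {V : Type*} [Fintype V] [DecidableEq V] (G : PDGraph V) (hG : G.IsMPDAG)
    (X Y Z : Finset V) (hXY : Disjoint X Y) (hXZ : Disjoint X Z) (hYZ : Disjoint Y Z)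
    (hpath : ∃ p : List V, G.IsPossiblyCausalPath p ∧ PDGraph.IsProperFromTo X Y p ∧
      G.StartsUndirected p ∧ ∀ w ∈ p, w ∉ Z) :
    ¬ G.Identifiable X Y Z := by
  obtain ⟨p, hp, hpr, hu, hpZ⟩ := hpath
  obtain ⟨x, y, l, hw, hlY, hun, hmin⟩ :=
    PDGraph.exists_isWitness_minimal (PDGraph.exists_isWitness hp hpr hu hpZ)
  obtain ⟨D₁, D₂, hD₁, hD₂, hc₁, hc₂, hyx⟩ := PDGraph.exists_represents_pair hG hw hun hmin
  have hn := hw.nodup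
  have hxl : x ∉ l := fun h => (List.nodup_cons.1 hn).1 (List.mem_cons_of_mem _ h)
  have hxX := hw.mem
  set g₁ : V → (V → ℝ) → ℝ≥0∞ := pathFactor (x :: y :: l) with hg₁
  -- Here the first coupling is charged to `x` instead of `y`. By symmetry of the kernel the full
  -- product is unchanged.
  set g₂ : V → (V → ℝ) → ℝ≥0∞ := fun i v =>
    (if i = x then signKernel 2⁻¹ (v y) (v x) else 1) * pathFactor (y :: l) i v with hg₂
  have hcp₁ : IsParentCoupling D₁ g₁ := isParentCoupling_pathFactor hn hc₁
  have hcp₂ : IsParentCoupling D₂ g₂ := by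
    intro i
    by_cases hi : i = x
    · subst hi
      refine Or.inr ⟨y, hyx, fun v => ?_⟩
      simp only [hg₂, if_true, pathFactor_of_notMem hxl, mul_one]
    · simpa only [hg₂, if_neg hi, one_mul] using isParentCoupling_pathFactor (List.nodup_cons.1 hn).2 hc₂ i
  set F₁ := truncatedFactorization fun i v => stdGaussianPDF (v i) * g₁ i v with hF₁
  set F₂ := truncatedFactorization fun i v => stdGaussianPDF (v i) * g₂ i v with hF₂
  have hobs : F₁.obs = F₂.obs := by
    rw [hF₁, hF₂, truncatedFactorization_obs, truncatedFactorization_obs]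
    funext v
    simp only [hg₁, hg₂, Finset.prod_mul_distrib]
    rw [prod_pathFactor (by simp), prod_pathFactor (by simp), Finset.prod_ite_eq',
      if_pos (Finset.mem_univ _), chainWeight, signKernel_comm]
  intro hid
  -- One point of agreement suffices for a contradiction, as the effects differ everywhere.
  obtain ⟨v, hv⟩ := (hid D₁ D₂ F₁ F₂ hD₁ hD₂ (hcp₁.compatible hD₁.1) (hcp₂.compatible hD₂.1)
    hobs).exists
  have hprop : ∀ w ∈ y :: l, w ∈ Xᶜ := fun w h => Finset.mem_compl.2 (hw.proper w h)
  have hdo₁ : (fun v : V → ℝ => ∏ i ∈ Xᶜ, (stdGaussianPDF (v i) * g₁ i v)) = fun v =>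
      (∏ i ∈ Xᶜ, stdGaussianPDF (v i)) * chainWeight 2⁻¹ x (y :: l) v := by
    funext v
    rw [Finset.prod_mul_distrib, prod_pathFactor hprop]
  -- Intervening on `X` deletes the factor of `x` and its coupling to `y`. Writing the result with
  -- leading correlation `0` lets the same integration lemmas treat both families.
  have hdo₂ : (fun v : V → ℝ => ∏ i ∈ Xᶜ, (stdGaussianPDF (v i) * g₂ i v)) = fun v =>
      (∏ i ∈ Xᶜ, stdGaussianPDF (v i)) * chainWeight 0 x (y :: l) v := by
    funext v
    simp only [hg₂]
    rw [Finset.prod_mul_distrib, Finset.prod_mul_distrib,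
      prod_pathFactor fun w h => hprop w (List.mem_cons_of_mem _ h), Finset.prod_ite_eq',
      if_neg (by simpa using hxX), chainWeight, signKernel_zero]
  have hlastY := hw.last
  have hT₁ : (X ∪ Y ∪ Z)ᶜ ⊆ Xᶜ := fun i hi => by
    simp only [Finset.mem_compl, Finset.mem_union, not_or] at hi ⊢
    exact hi.1.1
  have hT₂ : (X ∪ Z)ᶜ ⊆ Xᶜ := fun i hi => by
    simp only [Finset.mem_compl, Finset.mem_union, not_or] at hi ⊢
    exact hi.1
  have hin₁ : ∀ w ∈ (y :: l).dropLast, w ∈ (X ∪ Y ∪ Z)ᶜ := fun w h => by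
    have h' := List.mem_of_mem_dropLast h
    simp only [Finset.mem_compl, Finset.mem_union, not_or]
    exact ⟨⟨hw.proper w h', hlY w h⟩, hw.avoids w h'⟩
  have hin₂ : ∀ w ∈ y :: l, w ∈ (X ∪ Z)ᶜ := fun w h => by
    simp only [Finset.mem_compl, Finset.mem_union, not_or]
    exact ⟨hw.proper w h, hw.avoids w h⟩
  have hxT : x ∉ (X ∪ Y ∪ Z)ᶜ := by simp [hxX]
  have hlT : (y :: l).getLast (by simp) ∉ (X ∪ Y ∪ Z)ᶜ := by
    simp only [Finset.mem_compl, Finset.mem_union, not_not]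
    exact Or.inl (Or.inr hlastY)
  have hγ : ∀ S : Finset V, ∏ i ∈ S, stdGaussianPDF (v i) ≠ 0 ∧
      ∏ i ∈ S, stdGaussianPDF (v i) ≠ ∞ := fun S =>
    ⟨Finset.prod_ne_zero_iff.2 fun i _ =>
      (ProbabilityTheory.gaussianPDF_pos 0 one_ne_zero (v i)).ne',
      ENNReal.prod_ne_top fun i _ => ProbabilityTheory.gaussianPDF_ne_top⟩
  have h0 : (0 : ℝ) ≤ 2⁻¹ := by norm_num
  have h1 : (2⁻¹ : ℝ) < 1 := by norm_num
  unfold InterventionalFamily.condEffect at hv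
  rw [hF₁, hF₂, marginalDensity_truncatedFactorization _
      (Finset.subset_union_left.trans Finset.subset_union_left),
    marginalDensity_truncatedFactorization _ Finset.subset_union_left,
    marginalDensity_truncatedFactorization _
      (Finset.subset_union_left.trans Finset.subset_union_left),
    marginalDensity_truncatedFactorization _ Finset.subset_union_left, hdo₁, hdo₂,
    lmarginal_chainWeight h0 h1 hn hT₂ hin₂, lmarginal_chainWeight le_rfl one_pos hn hT₂ hin₂,
    lmarginal_chainWeight_dropLast h0 h1 hn hT₁ hxT hin₁ hlT,
    lmarginal_chainWeight_dropLast le_rfl one_pos hn hT₁ hxT hin₁ hlT,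
    div_eq_mul_inv, div_eq_mul_inv] at hv
  -- The denominators agree, and so do the Gaussian factors. What remains is a kernel of positive
  -- correlation, which never takes the value `1`.
  rw [ENNReal.mul_left_inj (ENNReal.inv_ne_zero.2 (hγ _).2) (ENNReal.inv_ne_top.2 (hγ _).1),
    ENNReal.mul_right_inj (hγ _).1 (hγ _).2, zero_mul, signKernel_zero, ← pow_succ'] at hv
  exact signKernel_ne_one (by positivity) (pow_lt_one₀ h0 h1 (Nat.succ_ne_zero _)) _ _ hv
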